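/- A rank $3$ simple matroid $M$ consists of a finite set $E$ of elements and a collection $F$ of subsets of $E$, the (rank $2$) flats, each with at least two elements, such that any two distinct elements lie in exactly one flat and there are at least two flats. Let $\Gamma_M$ be the bipartite graph with vertex set $E\sqcup F$ and an edge between $e\in E$ and $f\in F$ whenever $e\in f$, regarded as a metric graph with all edges of length $1$, and let $D_M=\sum_{e\in E}[e]$, a divisor on $\Gamma_M$. Metric graphs are finite and connected and may have unbounded edges. A tropical modification of a metric graph is a metric graph obtained from it by successively gluing finitely many unbounded edges $[0,\infty]$, each along its end $0$, to points that are not at infinity. A totally degenerate metrized complex over an algebraically closed field $k$ is a metric graph with a finite set of vertices (containing all points of valency $\neq 2$ that are not at infinity; the ends at infinity are not counted among these vertices), together with a copy $C_v$ of $\mathbb P^1_k$ for every vertex $v$ and an injective map $\mathrm{red}_v$ from the set of outgoing edge directions at $v$ to $C_v(k)$; its genus is the first Betti number of the graph. A finite harmonic morphism between such complexes consists of * a continuous surjective map $\phi$ of the graphs that takes vertices to vertices, takes bounded edges onto bounded edges and unbounded edges onto unbounded edges, and stretches each edge by a positive integer factor, its expansion factor; * for every vertex $v$ of the source, a finite morphism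 $\phi_v\colon C_v\to C_{\phi(v)}$, such that for every direction $t'$ at $\phi(v)$ the expansion factors of the directions at $v$ above $t'$ sum to $\deg\phi_v$; for every direction $t$ at $v$ above $t'$, $\phi_v(\mathrm{red}_v(t))=\mathrm{red}_{\phi(v)}(t')$ and the ramification index of $\phi_v$ at $\mathrm{red}_v(t)$ is the expansion factor of $t$; and every point of $\phi_v^{-1}(\mathrm{red}_{\phi(v)}(t'))$ is $\mathrm{red}_v(t)$ for some direction $t$ at $v$ above $t'$. It is tame if every $\phi_v$ is separable and tamely ramified. The fiber over a point $y\in C_w(k)$, for a vertex $w$ of the target, is the divisor of all points $x\in C_v(k)$ with $\phi(v)=w$ and $\phi_v(x)=y$, counted with ramification index. A divisor on the curves $C_v$ lifts the divisor on the graph that is obtained from it by replacing every point of $C_v$ with $v$. **Proposition.** Let $M$ be any rank $3$ simple matroid, let $e$ be any element of $M$, and let $k$ be an algebraically closed field of characteristic not $2$. Then $\Gamma_M$ has a tropical modification $\widetilde\Gamma_M$ which is the underlying metric graph of a totally degenerate metrized complex over $k$, with all vertices of $\Gamma_M$ among its vertices, and this metrized complex has a tame finite harmonic morphism to a totally degenerate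 metrized complex of genus $0$ over $k$, such that the fiber over some $k$-point of the curve at some vertex of the target is a lift of the divisor $D_M-[e]$. -/

import Mathlib

open Polynomial

universe u v

noncomputable section

namespace TropLift

/-! ### Rank 3 simple matroids -/

/-- A rank 3 simple matroid on a finite set `E` of elements, given by its collection of
rank 2 flats (simply called flats): any two distinct elements lie in exactly one flat, every
flat has at least two elements, and there are at least two flats. -/
structure RankThreeSimpleMatroid (E : Type u) [Fintype E] where
  flats : Finset (Finset E)
  existsUnique_flat : ∀ a b : E, a ≠ b → ∃! f : Finset E, f ∈ flats ∧ a ∈ f ∧ b ∈ f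
  two_le_card_of_mem : ∀ f ∈ flats, 2 ≤ f.card
  two_le_card_flats : 2 ≤ flats.card

/-! ### Metric graphs -/

/-- A metric graph, possibly with unbounded edges, together with a finite set `V` of (finite)
vertices. It is presented by its set `H` of half-edges, that is, of pairs of a vertex
and an outgoing tangent direction at this vertex. The half-edge `h` starts at the vertex
`base h`, and `inv h` is the opposite half of the same edge. If `inv h ≠ h`, then `{h, inv h}` is
a bounded edge, of length `len h`. If `inv h = h`, then `h` is a leg: an unbounded edge `[0, ∞]`
attached to `base h` at `0`, whose other end is an infinite vertex (which is not in `V`); the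
value `len h` has no meaning then. Loops and multiple edges are allowed. -/
structure MetricGraph where
  V : Type u
  H : Type u
  fintypeV : Fintype V
  fintypeH : Fintype H
  base : H → V
  inv : H → H
  inv_inv : ∀ h, inv (inv h) = h
  len : H → ℝ
  len_pos : ∀ h, inv h ≠ h → 0 < len h
  len_inv : ∀ h, len (inv h) = len h
  nonempty : Nonempty V
  connected : ∀ v w : V,
    Relation.ReflTransGen (fun a b => ∃ h, base h = a ∧ base (inv h) = b) v w

attribute [instance] MetricGraph.fintypeV MetricGraph.fintypeH MetricGraph.nonempty

namespace MetricGraph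

/-- The half-edge `h` is an unbounded edge. -/
def IsLeg (Γ : MetricGraph.{u}) (h : Γ.H) : Prop := Γ.inv h = h

open scoped Classical in
/-- The first Betti number: the number of bounded edges, minus the number of vertices,
plus one (the graph is connected). -/
def firstBetti (Γ : MetricGraph.{u}) : ℤ :=
  (Fintype.card {h : Γ.H // ¬ Γ.IsLeg h} : ℤ) / 2 - Fintype.card Γ.V + 1

/-- An isometry of metric graphs which identifies the chosen vertices. -/
structure Iso (Γ Γ' : MetricGraph.{u}) where
  onV : Γ.V ≃ Γ'.V
  onH : Γ.H ≃ Γ'.H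
  base_onH : ∀ h, Γ'.base (onH h) = onV (Γ.base h)
  inv_onH : ∀ h, Γ'.inv (onH h) = onH (Γ.inv h)
  len_onH : ∀ h, ¬ Γ.IsLeg h → Γ'.len (onH h) = Γ.len h

/-- Attach finitely many new unbounded edges, indexed by `J`: the edge `j` is glued to the
vertex `p j`. -/
def attachLegs (Γ : MetricGraph.{u}) (J : Type u) [Fintype J] (p : J → Γ.V) :
    MetricGraph.{u} where
  V := Γ.V
  H := Γ.H ⊕ J
  fintypeV := inferInstance
  fintypeH := inferInstance
  base := Sum.elim Γ.base p
  inv := Sum.map Γ.inv id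
  inv_inv := by rintro (h | j) <;> simp [Γ.inv_inv]
  len := Sum.elim Γ.len 0
  len_pos := by
    rintro (h | j) hh
    · exact Γ.len_pos h (fun h' => hh (by simp [h']))
    · simp at hh
  len_inv := by rintro (h | j) <;> simp [Γ.len_inv]
  nonempty := Γ.nonempty
  connected := fun v w => by
    refine Relation.ReflTransGen.mono ?_ _ _ (Γ.connected v w)
    rintro a b ⟨h, h1, h2⟩
    exact ⟨Sum.inl h, by simpa using h1, by simpa using h2⟩

/-- The opposite half-edge after the subdivision of the edges given by `S`, see `subdivide`. -/
def subdivideInv (Γ : MetricGraph.{u}) (S : Finset Γ.H) : Γ.H ⊕ (S ⊕ S) → Γ.H ⊕ (S ⊕ S) :=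
  open scoped Classical in
  Sum.elim
    (fun h => if hS : h ∈ S then Sum.inr (Sum.inl ⟨h, hS⟩)
      else if hS' : Γ.inv h ∈ S then Sum.inr (Sum.inr ⟨Γ.inv h, hS'⟩)
      else Sum.inl (Γ.inv h))
    (Sum.elim (fun s => Sum.inl s.1)
      (fun s => if Γ.inv s.1 = s.1 then Sum.inr (Sum.inr s) else Sum.inl (Γ.inv s.1)))

/-- The length function after the subdivision of the edges given by `S`, see `subdivide`. -/
def subdivideLen (Γ : MetricGraph.{u}) (S : Finset Γ.H) (t : Γ.H → ℝ) : Γ.H ⊕ (S ⊕ S) → ℝ :=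
  open scoped Classical in
  Sum.elim
    (fun h => if h ∈ S then t h
      else if Γ.inv h ∈ S then Γ.len h - t (Γ.inv h)
      else Γ.len h)
    (Sum.elim (fun s => t s.1) (fun s => Γ.len s.1 - t s.1))

theorem subdivideInv_subdivideInv (Γ : MetricGraph.{u}) (S : Finset Γ.H)
    (hS : ∀ h ∈ S, Γ.inv h ∈ S → Γ.IsLeg h) (x : Γ.H ⊕ (S ⊕ S)) :
    Γ.subdivideInv S (Γ.subdivideInv S x) = x := by
  unfold IsLeg at hS
  rcases x with h | ⟨s, hs⟩ | ⟨s, hs⟩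
  · by_cases h1 : h ∈ S
    · simp [subdivideInv, h1]
    · by_cases h2 : Γ.inv h ∈ S
      · have h3 : h ≠ Γ.inv h := fun h4 => h1 (h4 ▸ h2)
        simp [subdivideInv, h1, h2, Γ.inv_inv, h3]
      · simp [subdivideInv, h1, h2, Γ.inv_inv]
  · simp [subdivideInv, hs]
  · by_cases h1 : Γ.inv s = s
    · simp [subdivideInv, h1]
    · have h2 : Γ.inv s ∉ S := fun h3 => h1 (hS s hs h3)
      simp [subdivideInv, h1, h2, hs, Γ.inv_inv]

theorem subdivideLen_pos (Γ : MetricGraph.{u}) (S : Finset Γ.H) (t : Γ.H → ℝ)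
    (ht : ∀ h ∈ S, 0 < t h) (ht' : ∀ h ∈ S, ¬ Γ.IsLeg h → t h < Γ.len h)
    (x : Γ.H ⊕ (S ⊕ S)) (hx : Γ.subdivideInv S x ≠ x) : 0 < Γ.subdivideLen S t x := by
  unfold IsLeg at ht'
  rcases x with h | ⟨s, hs⟩ | ⟨s, hs⟩
  · by_cases h1 : h ∈ S
    · simpa [subdivideLen, h1] using ht h h1
    · by_cases h2 : Γ.inv h ∈ S
      · have h3 : h ≠ Γ.inv h := fun h4 => h1 (h4 ▸ h2)
        have := ht' _ h2 (by rwa [Γ.inv_inv])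
        rw [Γ.len_inv] at this
        simpa [subdivideLen, h1, h2] using this
      · have := Γ.len_pos h
        simp only [subdivideInv, Sum.elim_inl, h1, h2, dite_false, ne_eq, Sum.inl.injEq] at hx
        simpa [subdivideLen, h1, h2] using this hx
  · simpa [subdivideLen] using ht s hs
  · have h1 : Γ.inv s ≠ s := fun h => hx (by simp [subdivideInv, h])
    simpa [subdivideLen] using ht' s hs h1

theorem subdivideLen_subdivideInv (Γ : MetricGraph.{u}) (S : Finset Γ.H) (t : Γ.H → ℝ)
    (hS : ∀ h ∈ S, Γ.inv h ∈ S → Γ.IsLeg h) (x : Γ.H ⊕ (S ⊕ S)) :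
    Γ.subdivideLen S t (Γ.subdivideInv S x) = Γ.subdivideLen S t x := by
  unfold IsLeg at hS
  rcases x with h | ⟨s, hs⟩ | ⟨s, hs⟩
  · by_cases h1 : h ∈ S
    · simp [subdivideInv, subdivideLen, h1]
    · by_cases h2 : Γ.inv h ∈ S
      · simp [subdivideInv, subdivideLen, h1, h2, Γ.len_inv]
      · simp [subdivideInv, subdivideLen, h1, h2, Γ.inv_inv, Γ.len_inv]
  · simp [subdivideInv, subdivideLen, hs]
  · by_cases h1 : Γ.inv s = s
    · simp [subdivideInv, subdivideLen, h1]
    · have h2 : Γ.inv s ∉ S := fun h3 => h1 (hS s hs h3)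
      simp [subdivideInv, subdivideLen, h1, h2, hs, Γ.inv_inv, Γ.len_inv]

theorem subdivide_connected (Γ : MetricGraph.{u}) (S : Finset Γ.H) (v w : Γ.V ⊕ S) :
    Relation.ReflTransGen
      (fun a b => ∃ x : Γ.H ⊕ (S ⊕ S),
        Sum.elim (fun h => Sum.inl (Γ.base h)) (Sum.elim Sum.inr Sum.inr) x = a ∧
        Sum.elim (fun h => Sum.inl (Γ.base h)) (Sum.elim Sum.inr Sum.inr)
          (Γ.subdivideInv S x) = b) v w := by
  set B : Γ.H ⊕ (S ⊕ S) → Γ.V ⊕ S :=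
    Sum.elim (fun h => Sum.inl (Γ.base h)) (Sum.elim Sum.inr Sum.inr) with hB
  set R : Γ.V ⊕ S → Γ.V ⊕ S → Prop :=
    fun a b => ∃ x : Γ.H ⊕ (S ⊕ S), B x = a ∧ B (Γ.subdivideInv S x) = b with hR
  have up : ∀ s : S, R (Sum.inl (Γ.base s.1)) (Sum.inr s) := fun s =>
    ⟨Sum.inl s.1, by simp [hB], by simp [hB, subdivideInv]⟩
  have down : ∀ s : S, R (Sum.inr s) (Sum.inl (Γ.base s.1)) := fun s =>
    ⟨Sum.inr (Sum.inl s), by simp [hB], by simp [hB, subdivideInv]⟩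
  have step : ∀ a b : Γ.V, (∃ h, Γ.base h = a ∧ Γ.base (Γ.inv h) = b) →
      Relation.ReflTransGen R (Sum.inl a) (Sum.inl b) := by
    rintro _ _ ⟨h, rfl, rfl⟩
    by_cases h0 : Γ.inv h = h
    · rw [h0]
    by_cases h1 : h ∈ S
    · refine (Relation.ReflTransGen.single (up ⟨h, h1⟩)).tail
        ⟨Sum.inr (Sum.inr ⟨h, h1⟩), by simp [hB], by simp [hB, subdivideInv, h0]⟩
    · by_cases h2 : Γ.inv h ∈ S
      · refine (Relation.ReflTransGen.single ?_).tail (down ⟨Γ.inv h, h2⟩)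
        exact ⟨Sum.inl h, by simp [hB], by simp [hB, subdivideInv, h1, h2]⟩
      · exact Relation.ReflTransGen.single
          ⟨Sum.inl h, by simp [hB], by simp [hB, subdivideInv, h1, h2]⟩
  have main : ∀ a b : Γ.V, Relation.ReflTransGen R (Sum.inl a) (Sum.inl b) := by
    intro a b
    induction Γ.connected a b with
    | refl => exact Relation.ReflTransGen.refl
    | tail _ h ih => exact ih.trans (step _ _ h)
  rcases v with a | s <;> rcases w with b | s'
  · exact main a b
  · exact (main a _).tail (up s')
  · exact (main _ b).head (down s)
  · exact ((main _ _).head (down s)).tail (up s')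

/-- Subdivision, which does not change the metric space: for every `h` in `S`,
a new vertex is put on the edge of `h`, at the distance `t h` from `base h`. Here `S` contains at
most one of the two halves of a bounded edge. At the new vertex on the edge of `h`, there are two
outgoing half-edges: `Sum.inr (Sum.inl h)` is opposite to `h`, and `Sum.inr (Sum.inr h)` is
opposite to the old `inv h` if `h` lies on a bounded edge, and is a leg if `h` is a leg. -/
def subdivide (Γ : MetricGraph.{u}) (S : Finset Γ.H) (t : Γ.H → ℝ)
    (hS : ∀ h ∈ S, Γ.inv h ∈ S → Γ.IsLeg h)
    (ht : ∀ h ∈ S, 0 < t h)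
    (ht' : ∀ h ∈ S, ¬ Γ.IsLeg h → t h < Γ.len h) : MetricGraph.{u} where
  V := Γ.V ⊕ S
  H := Γ.H ⊕ (S ⊕ S)
  fintypeV := inferInstance
  fintypeH := inferInstance
  base := Sum.elim (fun h => Sum.inl (Γ.base h)) (Sum.elim Sum.inr Sum.inr)
  inv := Γ.subdivideInv S
  inv_inv := Γ.subdivideInv_subdivideInv S hS
  len := Γ.subdivideLen S t
  len_pos := Γ.subdivideLen_pos S t ht ht'
  len_inv := Γ.subdivideLen_subdivideInv S t hS
  nonempty := inferInstance
  connected := Γ.subdivide_connected S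

/-- `IsTropicalModification Γ Γ' ι` says that `Γ'` is a tropical modification of `Γ`, that is,
that `Γ'` is obtained from `Γ` by repeatedly gluing unbounded edges `[0, ∞]` to (finite) points;
`ι` is the inclusion of the vertices. Any finite point can be turned into a vertex by
a subdivision. -/
inductive IsTropicalModification (Γ : MetricGraph.{u}) :
    (Γ' : MetricGraph.{u}) → (Γ.V → Γ'.V) → Prop
  | refl : IsTropicalModification Γ Γ id
  | iso {Γ' Γ'' : MetricGraph.{u}} {ι : Γ.V → Γ'.V} (h : IsTropicalModification Γ Γ' ι)
      (i : Iso Γ' Γ'') : IsTropicalModification Γ Γ'' (fun v => i.onV (ι v))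
  | attachLegs {Γ' : MetricGraph.{u}} {ι : Γ.V → Γ'.V} (h : IsTropicalModification Γ Γ' ι)
      (J : Type u) [Fintype J] (p : J → Γ'.V) :
      IsTropicalModification Γ (Γ'.attachLegs J p) ι
  | subdivide {Γ' : MetricGraph.{u}} {ι : Γ.V → Γ'.V} (h : IsTropicalModification Γ Γ' ι)
      (S : Finset Γ'.H) (t : Γ'.H → ℝ)
      (hS : ∀ h ∈ S, Γ'.inv h ∈ S → Γ'.IsLeg h)
      (ht : ∀ h ∈ S, 0 < t h)
      (ht' : ∀ h ∈ S, ¬ Γ'.IsLeg h → t h < Γ'.len h) :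
      IsTropicalModification Γ (Γ'.subdivide S t hS ht ht') (fun v => Sum.inl (ι v))

end MetricGraph

/-! ### The graph and the divisor of a matroid -/

namespace RankThreeSimpleMatroid

variable {E : Type u} [Fintype E]

/-- The pairs of an element and a flat that contains it. -/
abbrev Flag (M : RankThreeSimpleMatroid E) : Type u :=
  {p : E × {f : Finset E // f ∈ M.flats} // p.1 ∈ p.2.1}

theorem exists_element (M : RankThreeSimpleMatroid E) : Nonempty E := by
  obtain ⟨f, hf⟩ := Finset.card_pos.1 (lt_of_lt_of_le Nat.zero_lt_two M.two_le_card_flats)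
  obtain ⟨a, -⟩ :=
    Finset.card_pos.1 (lt_of_lt_of_le Nat.zero_lt_two (M.two_le_card_of_mem f hf))
  exact ⟨a⟩

theorem levi_connected (M : RankThreeSimpleMatroid E)
    (v w : E ⊕ {f : Finset E // f ∈ M.flats}) :
    Relation.ReflTransGen
      (fun a b => ∃ h : M.Flag × Bool,
        (if h.2 then Sum.inr h.1.1.2 else Sum.inl h.1.1.1) = a ∧
        (if !h.2 then Sum.inr h.1.1.2 else Sum.inl h.1.1.1) = b) v w := by
  set R : E ⊕ {f : Finset E // f ∈ M.flats} → E ⊕ {f : Finset E // f ∈ M.flats} → Prop :=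
    fun a b => ∃ h : M.Flag × Bool,
        (if h.2 then Sum.inr h.1.1.2 else Sum.inl h.1.1.1) = a ∧
        (if !h.2 then Sum.inr h.1.1.2 else Sum.inl h.1.1.1) = b with hR
  have up : ∀ (a : E) (f : {f : Finset E // f ∈ M.flats}), a ∈ f.1 →
      R (Sum.inl a) (Sum.inr f) := fun a f h => ⟨(⟨(a, f), h⟩, false), by simp, by simp⟩
  have down : ∀ (a : E) (f : {f : Finset E // f ∈ M.flats}), a ∈ f.1 →
      R (Sum.inr f) (Sum.inl a) := fun a f h => ⟨(⟨(a, f), h⟩, true), by simp, by simp⟩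
  have main : ∀ a b : E, Relation.ReflTransGen R (Sum.inl a) (Sum.inl b) := by
    intro a b
    by_cases hab : a = b
    · rw [hab]
    · obtain ⟨f, ⟨hf, ha, hb⟩, -⟩ := M.existsUnique_flat a b hab
      exact (Relation.ReflTransGen.single (up a ⟨f, hf⟩ ha)).tail (down b ⟨f, hf⟩ hb)
  have mem : ∀ f : {f : Finset E // f ∈ M.flats}, ∃ a, a ∈ f.1 := fun f =>
    Finset.card_pos.1 (lt_of_lt_of_le Nat.zero_lt_two (M.two_le_card_of_mem f.1 f.2))
  rcases v with a | f <;> rcases w with b | f'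
  · exact main a b
  · obtain ⟨b, hb⟩ := mem f'
    exact (main a b).tail (up b f' hb)
  · obtain ⟨a, ha⟩ := mem f
    exact (main a b).head (down a f ha)
  · obtain ⟨a, ha⟩ := mem f
    obtain ⟨b, hb⟩ := mem f'
    exact ((main a b).head (down a f ha)).tail (up b f' hb)

/-- The Levi graph of `M`, as a metric graph with all edges of length one: its vertices
are the elements and the flats, and there is an edge between `a` and `f` when `a ∈ f`. The two
halves of the edge of a flag `x` are `(x, false)`, which starts at the element, and `(x, true)`,
which starts at the flat. -/
def leviGraph (M : RankThreeSimpleMatroid E) : MetricGraph.{u} where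
  V := E ⊕ {f : Finset E // f ∈ M.flats}
  H := M.Flag × Bool
  fintypeV := inferInstance
  fintypeH := open scoped Classical in inferInstance
  base := fun h => if h.2 then Sum.inr h.1.1.2 else Sum.inl h.1.1.1
  inv := fun h => (h.1, !h.2)
  inv_inv := by simp
  len := fun _ => 1
  len_pos := by simp
  len_inv := by simp
  nonempty := ⟨Sum.inl M.exists_element.some⟩
  connected := M.levi_connected

/-- The divisor on the vertices of the Levi graph which is the sum of the elements of `M`. -/
def matroidDivisor (M : RankThreeSimpleMatroid E) : M.leviGraph.V →₀ ℤ :=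
  ∑ a : E, Finsupp.single (Sum.inl a : E ⊕ {f : Finset E // f ∈ M.flats}) 1

/-- The element `a`, as a divisor on the Levi graph. -/
def elementDivisor (M : RankThreeSimpleMatroid E) (a : E) : M.leviGraph.V →₀ ℤ :=
  Finsupp.single (Sum.inl a : E ⊕ {f : Finset E // f ∈ M.flats}) 1

end RankThreeSimpleMatroid

/-! ### Finite morphisms from the projective line to itself

The set of `k`-points of the projective line is `OnePoint k`. -/

/-- A finite (that is, nonconstant) morphism from the projective line over `k` to itself,
`x ↦ num x / den x`. -/
structure P1Map (k : Type v) [Field k] where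
  num : k[X]
  den : k[X]
  coprime : IsCoprime num den
  nonconstant : 0 < max num.natDegree den.natDegree

namespace P1Map

variable {k : Type v} [Field k]

/-- The degree of the morphism. -/
def degree (f : P1Map k) : ℕ := max f.num.natDegree f.den.natDegree

open scoped Classical in
/-- The map on `k`-points. -/
def eval (f : P1Map k) : OnePoint k → OnePoint k
  | OnePoint.infty =>
      if f.den.natDegree < f.num.natDegree then OnePoint.infty
      else OnePoint.some (f.num.coeff f.den.natDegree / f.den.leadingCoeff)
  | OnePoint.some a =>
      if f.den.eval a = 0 then OnePoint.infty
      else OnePoint.some (f.num.eval a / f.den.eval a)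

/-- The polynomial whose homogenization, in the degree of `f`, defines the fiber of `f`
over `y`. -/
def fiberPoly (f : P1Map k) : OnePoint k → k[X]
  | OnePoint.infty => f.den
  | OnePoint.some y => f.num - C y * f.den

/-- The multiplicity of `x` in the fiber of `f` over `y`. -/
def fiberMult (f : P1Map k) (y : OnePoint k) : OnePoint k → ℕ
  | OnePoint.infty => f.degree - (f.fiberPoly y).natDegree
  | OnePoint.some a => (f.fiberPoly y).rootMultiplicity a

/-- The ramification index of `f` at `x`. -/
def ramIndex (f : P1Map k) (x : OnePoint k) : ℕ := f.fiberMult (f.eval x) x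

/-- `f` is tamely ramified: it is separable (generically étale), and no ramification
index is divisible by the characteristic of `k`. -/
def IsTame (f : P1Map k) : Prop :=
  derivative f.num * f.den - f.num * derivative f.den ≠ 0 ∧
    ∀ x : OnePoint k, (f.ramIndex x : k) ≠ 0

theorem finite_fiber (f : P1Map k) (y : OnePoint k) : {x | f.eval x = y}.Finite := by
  have hden : f.den ≠ 0 := by
    intro h
    have h1 := f.coprime
    have h2 := f.nonconstant
    rw [h, isCoprime_zero_right] at h1
    rw [h, Polynomial.natDegree_eq_zero_of_isUnit h1] at h2
    simp at h2
  have hne : f.fiberPoly y ≠ 0 := by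
    cases y with
    | infty => exact hden
    | coe y =>
      intro h
      have h0 : f.num = C y * f.den := sub_eq_zero.1 h
      have h1 : IsUnit f.den := f.coprime.isUnit_of_dvd' ⟨C y, by rw [h0, mul_comm]⟩ dvd_rfl
      have h2 := f.nonconstant
      have h3 := Polynomial.natDegree_eq_zero_of_isUnit h1
      have h4 : f.num.natDegree ≤ 0 := by
        rw [h0, ← h3]
        exact Polynomial.natDegree_C_mul_le _ _
      omega
  refine Set.Finite.subset
    (((f.fiberPoly y).rootSet_finite k).image (OnePoint.some : k → OnePoint k) |>.insert
      OnePoint.infty) ?_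
  intro x hx
  cases x with
  | infty => exact Set.mem_insert _ _
  | coe a =>
    refine Set.mem_insert_of_mem _ ⟨a, ?_, rfl⟩
    rw [Polynomial.mem_rootSet]
    refine ⟨hne, ?_⟩
    change f.eval (OnePoint.some a) = y at hx
    by_cases ha : f.den.eval a = 0
    · have : y = OnePoint.infty := by rw [← hx]; simp [eval, ha]
      subst this
      simpa [fiberPoly] using ha
    · have : y = OnePoint.some (f.num.eval a / f.den.eval a) := by
        rw [← hx]; simp [eval, ha]
      subst this
      simp [fiberPoly, ha]

end P1Map

/-! ### Metrized complexes -/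

/-- A totally degenerate metrized complex of curves over the algebraically closed field `k`
with underlying metric graph `Γ`: every vertex `v` carries a curve `C_v` of genus zero, that
is, a copy of the projective line, and every outgoing tangent direction `h` at `v` is
identified with a point `red h` of `C_v`, different directions with different points. -/
structure TotallyDegenerateComplex (k : Type v) [Field k] (Γ : MetricGraph.{u}) where
  red : Γ.H → OnePoint k
  red_injective : ∀ h h' : Γ.H, Γ.base h = Γ.base h' → red h = red h' → h = h'

namespace TotallyDegenerateComplex

variable {k : Type v} [Field k] {Γ Γ' : MetricGraph.{u}}

/-- The genus of a metrized complex, i.e., the first Betti number of the graph plus the sum of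
the genera of the curves `C_v`, which are zero here. -/
def genus (_X : TotallyDegenerateComplex k Γ) : ℤ := Γ.firstBetti

/-- The divisors on a metrized complex that are supported on the curves `C_v`: finite formal
sums of points `(v, x)`, where `v` is a vertex and `x` is a point of `C_v`. -/
abbrev CurveDivisor (_X : TotallyDegenerateComplex k Γ) : Type (max u v) :=
  (Γ.V × OnePoint k) →₀ ℤ

/-- The divisor on the graph that a divisor on a metrized complex lifts: a point of `C_v` is
replaced with `v`. -/
def toGraphDivisor (X : TotallyDegenerateComplex k Γ) (D : X.CurveDivisor) : Γ.V →₀ ℤ :=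
  D.mapDomain Prod.fst

open scoped Classical in
/-- A finite harmonic morphism of totally degenerate metrized complexes. -/
structure FiniteHarmonicMorphism (X : TotallyDegenerateComplex k Γ)
    (Y : TotallyDegenerateComplex k Γ') where
  /-- The underlying morphism of metric graphs takes vertices to vertices, and
  bounded (resp. unbounded) edges to bounded (resp. unbounded) edges. -/
  onV : Γ.V → Γ'.V
  onH : Γ.H → Γ'.H
  surjective_onV : Function.Surjective onV
  surjective_onH : Function.Surjective onH
  base_onH : ∀ h, Γ'.base (onH h) = onV (Γ.base h)
  inv_onH : ∀ h, Γ'.inv (onH h) = onH (Γ.inv h)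
  isLeg_onH : ∀ h, Γ'.IsLeg (onH h) ↔ Γ.IsLeg h
  /-- It stretches every edge by a positive integer, its expansion factor. -/
  expansion : Γ.H → ℕ
  expansion_pos : ∀ h, 0 < expansion h
  expansion_inv : ∀ h, expansion (Γ.inv h) = expansion h
  len_onH : ∀ h, ¬ Γ.IsLeg h → Γ'.len (onH h) = expansion h * Γ.len h
  /-- The finite morphism from the curve `C_v` to the curve `C_{onV v}`. -/
  curveMap : Γ.V → P1Map k
  /-- Harmonicity: at every vertex `v`, the sum of the expansion factors of the directions
  above a given direction at `onV v` does not depend on that direction. It is the local degree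
  at `v`, and agrees with the degree of the morphism of curves. -/
  harmonic : ∀ (v : Γ.V) (h' : Γ'.H), Γ'.base h' = onV v →
    ∑ h : Γ.H with Γ.base h = v ∧ onH h = h', expansion h = (curveMap v).degree
  /-- The morphisms of curves are compatible with the morphism of graphs. -/
  eval_red : ∀ h, (curveMap (Γ.base h)).eval (X.red h) = Y.red (onH h)
  ramIndex_red : ∀ h, (curveMap (Γ.base h)).ramIndex (X.red h) = expansion h
  /-- Every point of `C_v` above the point of a direction is the point of a direction. -/
  exists_red : ∀ (v : Γ.V) (h' : Γ'.H), Γ'.base h' = onV v →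
    ∀ x : OnePoint k, (curveMap v).eval x = Y.red h' →
      ∃ h, Γ.base h = v ∧ onH h = h' ∧ X.red h = x

namespace FiniteHarmonicMorphism

variable {X : TotallyDegenerateComplex k Γ} {Y : TotallyDegenerateComplex k Γ'}

/-- The morphism is tame: all morphisms of curves are tamely ramified. -/
def IsTame (φ : FiniteHarmonicMorphism X Y) : Prop := ∀ v, (φ.curveMap v).IsTame

open scoped Classical in
/-- The fiber of a finite harmonic morphism over the point `y` of the curve `C_w` of the target,
as a divisor: all points above it, with their ramification indices as multiplicities. -/
def fiber (φ : FiniteHarmonicMorphism X Y) (w : Γ'.V) (y : OnePoint k) : X.CurveDivisor :=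
  Finsupp.ofSupportFinite
    (fun p => if φ.onV p.1 = w ∧ (φ.curveMap p.1).eval p.2 = y
      then ((φ.curveMap p.1).ramIndex p.2 : ℤ) else 0)
    (Set.Finite.subset (Set.finite_iUnion fun v : Γ.V =>
        ((φ.curveMap v).finite_fiber y).image fun x => (v, x)) (by
      intro p hp
      have h : φ.onV p.1 = w ∧ (φ.curveMap p.1).eval p.2 = y := by
        by_contra h
        simp [h] at hp
      exact Set.mem_iUnion.2 ⟨p.1, p.2, h.2, rfl⟩))

end FiniteHarmonicMorphism

end TotallyDegenerateComplex

end TropLift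

end

open TropLift TropLift.MetricGraph TropLift.TotallyDegenerateComplex

/-! The source is spread over a tree by a map with all expansion factors equal to one, modelled on
the projection of a point configuration from `e`. All elements other than `e` go to the root. All
flats through `e` go to one neighbour of the root, and `e` goes to a leaf beyond it. Each flat that
avoids `e` gets a leaf of its own next to the root. Every leaf of the tree carries an unbounded
edge.

The local degrees are forced by the flags over a full direction: 1 at an element other than `e` (it
spans a unique flat with `e`), `|f| - 1` at a flat `f` through `e`, `|f|` at a flat `f` avoiding
`e`, and the number of flats through `e` at `e`. Wherever a direction has too few edges above it,
unbounded edges are glued on until the count is right; this is the tropical modification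
(`nonempty_above_equiv_sheet`, `projection`). The fiber over the root then consists of the elements
other than `e`, each with local degree 1, which is the required divisor
(`sum_card_sheet_eq_mapDomain`).

The lift to metrized complexes is local (`BalancedCover.exists_isTame_fiber`). With expansion
factors one, every vertex may carry any tame map of the prescribed degree, provided the directions
of the tree are marked by points that are branch points of none of these maps. Tame maps of every
positive degree exist outside characteristic 2 (`P1Map.exists_isTame`), and a separable map has only
finitely many branch points (`finite_not_isUnramifiedOver`). -/

namespace TropLift

/-! ### Ramification of maps of the projective line -/

namespace P1Map

variable {k : Type v} [Field k]

/-- The numerator of the derivative of `f`. -/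
noncomputable def wronskian (f : P1Map k) : k[X] :=
  derivative f.num * f.den - f.num * derivative f.den

theorem den_ne_zero (f : P1Map k) : f.den ≠ 0 := by
  intro h
  have h1 := f.coprime
  have h2 := f.nonconstant
  rw [h, isCoprime_zero_right] at h1
  rw [h, Polynomial.natDegree_eq_zero_of_isUnit h1] at h2
  simp at h2

theorem fiberPoly_ne_zero (f : P1Map k) (y : OnePoint k) : f.fiberPoly y ≠ 0 := by
  cases y with
  | infty => exact f.den_ne_zero
  | coe y =>
    intro h
    have h0 : f.num = C y * f.den := sub_eq_zero.1 h
    have h1 : IsUnit f.den := f.coprime.isUnit_of_dvd' ⟨C y, by rw [h0, mul_comm]⟩ dvd_rfl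
    have h2 := f.nonconstant
    have h3 := Polynomial.natDegree_eq_zero_of_isUnit h1
    have h4 : f.num.natDegree ≤ 0 := by
      rw [h0, ← h3]
      exact Polynomial.natDegree_C_mul_le _ _
    omega

theorem num_eval_ne_zero (f : P1Map k) {a : k} (h : f.den.eval a = 0) : f.num.eval a ≠ 0 := by
  intro h'
  obtain ⟨p, q, hpq⟩ := f.coprime
  have := congrArg (Polynomial.eval a) hpq
  simp [h, h'] at this

theorem eval_infty (f : P1Map k) : f.eval OnePoint.infty =
    if f.den.natDegree < f.num.natDegree then OnePoint.infty
      else ((f.num.coeff f.den.natDegree / f.den.leadingCoeff : k) : OnePoint k) := by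
  unfold eval
  rfl

theorem eval_coe (f : P1Map k) (a : k) : f.eval (a : OnePoint k) =
    open scoped Classical in
    if f.den.eval a = 0 then OnePoint.infty
      else ((f.num.eval a / f.den.eval a : k) : OnePoint k) := by
  unfold eval
  rfl

theorem eval_coe_eq_iff (f : P1Map k) (a : k) (y : OnePoint k) :
    f.eval (a : OnePoint k) = y ↔ (f.fiberPoly y).eval a = 0 := by
  rw [eval_coe]
  cases y with
  | infty => by_cases h : f.den.eval a = 0 <;> simp [fiberPoly, h]
  | coe y =>
    by_cases h : f.den.eval a = 0
    · simp [fiberPoly, h, f.num_eval_ne_zero h]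
    · simp [fiberPoly, h, div_eq_iff, sub_eq_zero]

theorem ramIndex_coe (f : P1Map k) (a : k) :
    f.ramIndex (a : OnePoint k) = (f.fiberPoly (f.eval a)).rootMultiplicity a := rfl

theorem ramIndex_coe_pos (f : P1Map k) (a : k) : 0 < f.ramIndex (a : OnePoint k) := by
  rw [ramIndex_coe, rootMultiplicity_pos (f.fiberPoly_ne_zero _), IsRoot.def,
    ← f.eval_coe_eq_iff]

/-- A root of multiplicity `r` of a polynomial is a root of its derivative of multiplicity at least
`r - 1`, in any characteristic. Replacing `num` by `num - y * den` does not change the Wronskian, so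
this applies to the fiber polynomial. -/
theorem pow_ramIndex_sub_one_dvd_wronskian (f : P1Map k) (a : k) :
    (X - C a) ^ (f.ramIndex (a : OnePoint k) - 1) ∣ f.wronskian := by
  rw [ramIndex_coe]
  generalize f.eval a = y
  set r := (f.fiberPoly y).rootMultiplicity a
  have h1 : (X - C a) ^ r ∣ f.fiberPoly y := pow_rootMultiplicity_dvd _ _
  have h2 : (X - C a) ^ (r - 1) ∣ derivative (f.fiberPoly y) :=
    pow_sub_one_dvd_derivative_of_pow_dvd h1
  have h3 : (X - C a) ^ (r - 1) ∣ f.fiberPoly y := (pow_dvd_pow _ (Nat.sub_le _ _)).trans h1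
  cases y with
  | infty => exact dvd_sub (h3.mul_left _) (h2.mul_left _)
  | coe y =>
    have : f.wronskian = derivative (f.fiberPoly y) * f.den - f.fiberPoly y * derivative f.den := by
      simp [wronskian, fiberPoly]
      ring
    rw [this]
    exact dvd_sub (h2.mul_right _) (h3.mul_right _)

theorem ramIndex_coe_eq_one (f : P1Map k) {a : k} (h : f.wronskian.eval a ≠ 0) :
    f.ramIndex (a : OnePoint k) = 1 := by
  have h1 := f.ramIndex_coe_pos a
  by_contra h2
  refine h (dvd_iff_isRoot.1 ((dvd_pow_self _ ?_).trans (f.pow_ramIndex_sub_one_dvd_wronskian a)))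
  omega

/-- Ramification index three or more would give the Wronskian a square factor. This bounds the
indices without locating the ramification points. -/
theorem ramIndex_coe_le_two (f : P1Map k) (h : f.wronskian.Separable) (a : k) :
    f.ramIndex (a : OnePoint k) ≤ 2 := by
  by_contra! h2
  have h3 : (X - C a) * (X - C a) ∣ f.wronskian := by
    rw [← pow_two]
    exact (pow_dvd_pow _ (by omega)).trans (f.pow_ramIndex_sub_one_dvd_wronskian a)
  exact not_isUnit_X_sub_C a (h.squarefree _ h3)

/-- The coefficients of `num` and `y * den` in degree `f.degree` cancel only if `y` is the value at
infinity. -/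
theorem natDegree_fiberPoly (f : P1Map k) {y : k} (h : f.eval OnePoint.infty ≠ y) :
    (f.fiberPoly y).natDegree = f.degree := by
  have hle : (f.fiberPoly y).natDegree ≤ f.degree :=
    (natDegree_sub_le _ _).trans (max_le_max le_rfl (natDegree_C_mul_le _ _))
  refine le_antisymm hle (le_natDegree_of_ne_zero ?_)
  rw [eval_infty] at h
  split_ifs at h with h1
  · have : f.degree = f.num.natDegree := max_eq_left h1.le
    rw [this]
    simp only [fiberPoly, coeff_sub, coeff_C_mul]
    rw [coeff_eq_zero_of_natDegree_lt h1]
    have : f.num ≠ 0 := by rintro h; simp [h] at h1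
    simpa using this
  · have : f.degree = f.den.natDegree := max_eq_right (not_lt.1 h1)
    rw [this]
    simp only [fiberPoly, coeff_sub, coeff_C_mul, coeff_natDegree]
    intro h2
    apply h
    rw [sub_eq_zero.1 h2, mul_div_cancel_right₀]
    exact leadingCoeff_ne_zero.2 f.den_ne_zero

/-- The point `y` is not a branch point of `f`. -/
def IsUnramifiedOver (f : P1Map k) (y : k) : Prop :=
  Nat.card {x : OnePoint k // f.eval x = (y : OnePoint k)} = f.degree ∧
    ∀ x : OnePoint k, f.eval x = (y : OnePoint k) → f.ramIndex x = 1

/-- The fiber is affine, so its polynomial has full degree. Its roots are simple because the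
Wronskian does not vanish at them, so over an algebraically closed field there are `f.degree` of
them. -/
theorem isUnramifiedOver_of_forall_ne [IsAlgClosed k] (f : P1Map k) {y : k}
    (h : f.eval OnePoint.infty ≠ y)
    (h' : ∀ a : k, f.wronskian.eval a = 0 → f.eval a ≠ y) : f.IsUnramifiedOver y := by
  classical
  have hne := f.fiberPoly_ne_zero y
  have hram : ∀ x : OnePoint k, f.eval x = (y : OnePoint k) → f.ramIndex x = 1 := by
    intro x hx
    cases x with
    | infty => exact absurd hx h
    | coe a => exact f.ramIndex_coe_eq_one fun h2 => h' a h2 hx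
  refine ⟨?_, hram⟩
  have hnodup : (f.fiberPoly y).roots.Nodup := by
    rw [Multiset.nodup_iff_count_le_one]
    intro a
    rw [count_roots]
    by_cases ha : f.eval a = y
    · have := hram a ha
      rw [ramIndex_coe, ha] at this
      exact this.le
    · rw [f.eval_coe_eq_iff] at ha
      rw [rootMultiplicity_eq_zero ha]
      exact Nat.zero_le _
  have hset : {x : OnePoint k | f.eval x = (y : OnePoint k)} =
      (((f.fiberPoly y).roots.toFinset.image (fun a : k => (a : OnePoint k)) :
        Finset (OnePoint k)) : Set (OnePoint k)) := by
    ext x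
    cases x with
    | infty => simp [h]
    | coe a => simp [f.eval_coe_eq_iff, hne]
  rw [← natDegree_fiberPoly f h, ← IsAlgClosed.card_roots_eq_natDegree,
    ← Multiset.toFinset_card_of_nodup hnodup,
    ← Finset.card_image_of_injective _ (OnePoint.coe_injective (X := k)),
    ← Set.ncard_coe_finset, ← hset]
  rfl

/-- The exceptional values lie among the images of the zeros of the Wronskian and the value at
infinity. The latter is discarded, branch point or not, to keep the fibers affine. -/
theorem finite_not_isUnramifiedOver [IsAlgClosed k] (f : P1Map k) (hf : f.wronskian ≠ 0) :
    {y : k | ¬ f.IsUnramifiedOver y}.Finite := by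
  have h1 : (insert (f.eval OnePoint.infty)
      ((fun a : k => f.eval a) '' (f.wronskian.rootSet k))).Finite :=
    ((f.wronskian.rootSet_finite k).image _).insert _
  refine (h1.preimage (OnePoint.coe_injective (X := k)).injOn).subset ?_
  intro y hy
  by_contra h2
  simp only [Set.mem_preimage, Set.mem_insert_iff, Set.mem_image, not_or, not_exists, not_and] at h2
  refine hy (f.isUnramifiedOver_of_forall_ne (Ne.symm h2.1) fun a ha => h2.2 a ?_)
  rw [mem_rootSet]
  exact ⟨hf, by simpa using ha⟩

/-! ### Tame maps of every degree -/

/-- The map `x ↦ x ^ m`. -/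
noncomputable def powMap (k : Type v) [Field k] (m : ℕ) (hm : 0 < m) : P1Map k where
  num := X ^ m
  den := 1
  coprime := isCoprime_one_right
  nonconstant := by simpa using hm

theorem isTame_powMap {m : ℕ} (hm : 0 < m) (h : (m : k) ≠ 0) : (powMap k m hm).IsTame := by
  have hW : (powMap k m hm).wronskian = C (m : k) * X ^ (m - 1) := by
    simp [wronskian, powMap, derivative_X_pow]
  refine ⟨?_, fun x => ?_⟩
  · change (powMap k m hm).wronskian ≠ 0
    rw [hW]
    exact mul_ne_zero (C_ne_zero.2 h) (pow_ne_zero _ X_ne_zero)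
  · cases x with
    | infty =>
      have h1 : (powMap k m hm).eval OnePoint.infty = OnePoint.infty := by
        simp [eval_infty, powMap, hm]
      rw [ramIndex, h1]
      simpa [fiberMult, powMap, degree, fiberPoly] using h
    | coe a =>
      by_cases ha : a = 0
      · have h1 : (powMap k m hm).eval (a : OnePoint k) = ((0 : k) : OnePoint k) := by
          simp [eval_coe_eq_iff, powMap, fiberPoly, ha, hm.ne']
        rw [ramIndex_coe, h1, ha]
        have h3 : rootMultiplicity 0 (X ^ m : k[X]) = m := by
          simpa using rootMultiplicity_X_sub_C_pow (0 : k) m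
        simpa [powMap, fiberPoly, h3] using h
      · rw [ramIndex_coe_eq_one]
        · simp
        · rw [hW]
          simp [h, ha]

/-- The map `x ↦ x ^ (n + 2) + (x - 1)⁻¹`, of degree `n + 3`. -/
noncomputable def powAddInvMap (k : Type v) [Field k] (n : ℕ) : P1Map k where
  num := X ^ (n + 2) * (X - C 1) + 1
  den := X - C 1
  coprime := ⟨1, - X ^ (n + 2), by ring⟩
  nonconstant := by simp only [natDegree_X_sub_C]; simp

theorem natDegree_num_powAddInvMap (n : ℕ) : (powAddInvMap k n).num.natDegree = n + 3 := by
  unfold powAddInvMap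
  simp only
  compute_degree!

/-- The pole at infinity has order `n + 2`, which is `-1` in `k`. At finite points the Wronskian is
separable, so the ramification indices are at most 2, and 2 is invertible. -/
theorem isTame_powAddInvMap {n : ℕ} (h2 : (2 : k) ≠ 0) (h : ((n + 3 : ℕ) : k) = 0) :
    (powAddInvMap k n).IsTame := by
  have hn : ((n + 2 : ℕ) : k) = -1 := by
    push_cast at h ⊢
    linear_combination h
  have hn' : ((n + 1 : ℕ) : k) = -2 := by
    push_cast at h ⊢
    linear_combination h
  have hW : (powAddInvMap k n).wronskian = - (X ^ (n + 1) * (X - C 1) ^ 2 + 1) := by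
    simp only [wronskian, powAddInvMap, derivative_add, derivative_mul, derivative_X_pow, hn,
      derivative_sub, derivative_X, derivative_C, derivative_one]
    simp
    ring
  have hsep : (powAddInvMap k n).wronskian.Separable := by
    rw [hW, separable_def]
    have hder : derivative (-(X ^ (n + 1) * (X - C 1) ^ 2 + 1 : k[X])) =
        C (-2) * X ^ n * (X - C 1) := by
      simp only [derivative_add, derivative_mul, hn', derivative_neg,
        derivative_sub, derivative_X, derivative_C, derivative_one, derivative_pow]
      simp
      ring
    rw [hder]
    -- With `W = -(X ^ (n + 1) * (X - 1) ^ 2 + 1)` and `W' = -2 * X ^ n * (X - 1)`, multiplying `W'`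
    -- by `X * (X - 1) / 2` reproduces the nonconstant part of `W`, and subtracting `W` leaves 1.
    refine ⟨-1, C (2⁻¹) * X * (X - C 1), ?_⟩
    have : (C (2⁻¹) * C 2 : k[X]) = 1 := by rw [← C_mul, inv_mul_cancel₀ h2, C_1]
    rw [C_neg]
    linear_combination -(X ^ (n + 1) * (X - C 1) ^ 2) * this
  refine ⟨hsep.ne_zero, fun x => ?_⟩
  cases x with
  | infty =>
    have h1 : (powAddInvMap k n).eval OnePoint.infty = OnePoint.infty := by
      rw [eval_infty, natDegree_num_powAddInvMap, if_pos]
      simp only [powAddInvMap, natDegree_X_sub_C]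
      omega
    have h3 : (powAddInvMap k n).den.natDegree = 1 := natDegree_X_sub_C _
    rw [ramIndex, h1]
    change (((max _ _ - _ : ℕ)) : k) ≠ 0
    change (((max _ _ - (powAddInvMap k n).den.natDegree : ℕ)) : k) ≠ 0
    rw [natDegree_num_powAddInvMap, h3, max_eq_left (by omega), show n + 3 - 1 = n + 2 from rfl, hn]
    simp
  | coe a =>
    have h3 := ramIndex_coe_le_two _ hsep a
    have h4 := (powAddInvMap k n).ramIndex_coe_pos a
    interval_cases (powAddInvMap k n).ramIndex (a : OnePoint k)
    · simp
    · simpa using h2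

/-- The power map is tame unless the characteristic divides `m`. In that case the pole of order `m`
is split into one of order `m - 1` at infinity and a simple one at 1. -/
theorem exists_isTame (hk : ringChar k ≠ 2) {m : ℕ} (hm : 0 < m) :
    ∃ f : P1Map k, f.degree = m ∧ f.IsTame := by
  have h2 : (2 : k) ≠ 0 := Ring.two_ne_zero hk
  by_cases h : (m : k) = 0
  · obtain ⟨n, rfl⟩ : ∃ n, m = n + 3 := by
      -- The subtraction does not truncate: 1 and 2 are nonzero in `k`, so `m` is at least 3.
      refine ⟨m - 3, ?_⟩
      have h1 : m ≠ 1 := by rintro rfl; simp at h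
      have h3 : m ≠ 2 := by rintro rfl; exact h2 (by simpa using h)
      omega
    refine ⟨powAddInvMap k n, ?_, isTame_powAddInvMap h2 h⟩
    have h3 : (powAddInvMap k n).den.natDegree = 1 := natDegree_X_sub_C _
    rw [degree, natDegree_num_powAddInvMap, h3, max_eq_left (by omega)]
  · exact ⟨powMap k m hm, by simp [degree, powMap], isTame_powMap hm h⟩

end P1Map

end TropLift

/-! ### Lifting a balanced cover to metrized complexes -/

namespace TropLift

/-- A local isometry of metric graphs away from the vertices, taking vertices to vertices,
such that the directions at a vertex `v` above a given direction at the image of `v`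
are parametrized by the type `D v`. -/
structure BalancedCover (Γ T : MetricGraph.{u}) (D : Γ.V → Type u) where
  onV : Γ.V → T.V
  onH : Γ.H → T.H
  surjective_onV : Function.Surjective onV
  base_onH : ∀ h, T.base (onH h) = onV (Γ.base h)
  inv_onH : ∀ h, T.inv (onH h) = onH (Γ.inv h)
  isLeg_onH : ∀ h, T.IsLeg (onH h) ↔ Γ.IsLeg h
  len_onH : ∀ h, ¬ Γ.IsLeg h → T.len (onH h) = Γ.len h
  balanced : ∀ (v : Γ.V) (t : T.H), T.base t = onV v →
    Nonempty ({h : Γ.H // Γ.base h = v ∧ onH h = t} ≃ D v)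

namespace BalancedCover

variable {Γ T : MetricGraph.{u}} {D : Γ.V → Type u}

theorem surjective_onH [∀ v, Nonempty (D v)] (c : BalancedCover Γ T D) :
    Function.Surjective c.onH := by
  intro t
  obtain ⟨v, hv⟩ := c.surjective_onV (T.base t)
  obtain ⟨i⟩ := c.balanced v t hv.symm
  obtain ⟨d⟩ := ‹∀ v, Nonempty (D v)› v
  exact ⟨(i.symm d).1, (i.symm d).2.2⟩

-- The maps at different vertices need no compatibility: each is tame of degree `|D v|`, and the
-- only common requirement is that the points marking the directions of `T` be unramified for all of
-- them. Then the fiber over such a point and the set of directions above are finite sets of the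
-- same size, and any bijection between them defines the reductions upstairs.
open scoped Classical in
theorem exists_isTame_fiber [∀ v, Fintype (D v)] [∀ v, Nonempty (D v)]
    (c : BalancedCover Γ T D) (k : Type v) [Field k] [IsAlgClosed k] (hk : ringChar k ≠ 2)
    (w : T.V) :
    ∃ (X : TotallyDegenerateComplex k Γ) (Y : TotallyDegenerateComplex k T)
      (φ : FiniteHarmonicMorphism X Y), φ.IsTame ∧ ∃ y : OnePoint k,
        X.toGraphDivisor (φ.fiber w y) =
          ∑ v : Γ.V with c.onV v = w, Finsupp.single v (Fintype.card (D v) : ℤ) := by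
  choose g hdeg htame using fun v : Γ.V =>
    P1Map.exists_isTame (k := k) hk (Fintype.card_pos (α := D v))
  have hfin : (⋃ v, {y : k | ¬ (g v).IsUnramifiedOver y}).Finite :=
    Set.finite_iUnion fun v => (g v).finite_not_isUnramifiedOver (htame v).1
  have hinf : Infinite ((⋃ v, {y : k | ¬ (g v).IsUnramifiedOver y})ᶜ : Set k) :=
    (Set.Finite.infinite_compl hfin).to_subtype
  -- One injection marks all half-edges of `T` at once, which is more than distinctness at each
  -- vertex. It exists because finitely many points have been removed from the infinite field `k`.
  obtain ⟨r⟩ : Nonempty (T.H ↪ ((⋃ v, {y : k | ¬ (g v).IsUnramifiedOver y})ᶜ : Set k)) :=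
    ⟨(Fintype.equivFin T.H).toEmbedding.trans
      (Fin.valEmbedding.trans (Infinite.natEmbedding _))⟩
  have hgood : ∀ (y : ((⋃ v, {y : k | ¬ (g v).IsUnramifiedOver y})ᶜ : Set k)) v,
      (g v).IsUnramifiedOver y := by
    rintro ⟨y, hy⟩ v
    simpa using fun h => hy (Set.mem_iUnion.2 ⟨v, h⟩)
  -- The fiber is taken over this point. It may coincide with a marked point; only unramifiedness
  -- matters.
  obtain ⟨y₀⟩ : Nonempty ((⋃ v, {y : k | ¬ (g v).IsUnramifiedOver y})ᶜ : Set k) := inferInstance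
  have hcard : ∀ v (t : T.H), T.base t = c.onV v →
      Nat.card {h : Γ.H // Γ.base h = v ∧ c.onH h = t} = Fintype.card (D v) := by
    intro v t ht
    obtain ⟨i⟩ := c.balanced v t ht
    rw [Nat.card_congr i, Nat.card_eq_fintype_card]
  have hequiv : ∀ v (t : T.H), T.base t = c.onV v →
      Nonempty ({h : Γ.H // Γ.base h = v ∧ c.onH h = t} ≃
        {x : OnePoint k // (g v).eval x = ((r t : k) : OnePoint k)}) := by
    intro v t ht
    have : Finite {x : OnePoint k // (g v).eval x = ((r t : k) : OnePoint k)} :=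
      (g v).finite_fiber _
    rw [← Finite.card_eq, hcard v t ht, (hgood (r t) v).1, hdeg]
  let i := fun v t ht => (hequiv v t ht).some
  let red : Γ.H → OnePoint k := fun h => (i (Γ.base h) (c.onH h) (c.base_onH h) ⟨h, rfl, rfl⟩).1
  -- `red` uses the bijection at the half-edge's own vertex and direction; this allows comparison
  -- within a fixed `v` and `t`.
  have hred : ∀ v t ht (h : {h : Γ.H // Γ.base h = v ∧ c.onH h = t}),
      (i v t ht h).1 = red h.1 := by
    rintro _ _ _ ⟨h, rfl, rfl⟩
    rfl
  have heval : ∀ h, (g (Γ.base h)).eval (red h) = ((r (c.onH h) : k) : OnePoint k) := fun h =>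
    (i (Γ.base h) (c.onH h) (c.base_onH h) ⟨h, rfl, rfl⟩).2
  let Y : TotallyDegenerateComplex k T :=
    { red := fun t => ((r t : k) : OnePoint k)
      red_injective := fun t t' _ h => r.injective (Subtype.ext (OnePoint.coe_injective h)) }
  let X : TotallyDegenerateComplex k Γ :=
    { red := red
      red_injective := by
        intro h h' hb hr
        -- Equal points of one curve have equal images, so the two half-edges lie above the same
        -- direction, where the chosen bijection separates them.
        have h1 := heval h
        rw [hr, hb, heval h'] at h1
        have h2 : c.onH h' = c.onH h := r.injective (Subtype.ext (OnePoint.coe_injective h1))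
        have ht := c.base_onH h
        have h3 : i (Γ.base h) (c.onH h) ht ⟨h, rfl, rfl⟩ =
            i (Γ.base h) (c.onH h) ht ⟨h', hb.symm, h2⟩ := by
          apply Subtype.ext
          rw [hred _ _ ht, hred _ _ ht]
          exact hr
        exact congrArg Subtype.val ((i _ _ ht).injective h3) }
  let φ : FiniteHarmonicMorphism X Y :=
    { onV := c.onV
      onH := c.onH
      surjective_onV := c.surjective_onV
      surjective_onH := c.surjective_onH
      base_onH := c.base_onH
      inv_onH := c.inv_onH
      isLeg_onH := c.isLeg_onH
      expansion := fun _ => 1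
      expansion_pos := fun _ => one_pos
      expansion_inv := fun _ => rfl
      len_onH := fun h hh => by simpa using c.len_onH h hh
      curveMap := g
      harmonic := fun v t ht => by
        rw [hdeg, ← hcard v t ht, Nat.card_eq_fintype_card, Fintype.card_subtype]
        simp
      eval_red := heval
      ramIndex_red := fun h => (hgood _ _).2 _ (heval h)
      exists_red := fun v t ht x hx => by
        obtain ⟨h, hh⟩ := (i v t ht).surjective ⟨x, hx⟩
        refine ⟨h.1, h.2.1, h.2.2, ?_⟩
        exact (hred v t ht h).symm.trans (congrArg Subtype.val hh) }
  refine ⟨X, Y, φ, htame, (y₀ : k), ?_⟩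
  have hfib : φ.fiber w (y₀ : k) = ∑ v : Γ.V with c.onV v = w,
      ∑ x ∈ ((g v).finite_fiber (y₀ : k)).toFinset, Finsupp.single (v, x) (1 : ℤ) := by
    ext ⟨v, x⟩
    have h1 : φ.fiber w (y₀ : k) (v, x) = if c.onV v = w ∧ (g v).eval x = ((y₀ : k) : OnePoint k)
        then ((g v).ramIndex x : ℤ) else 0 := rfl
    rw [h1, Finsupp.finsetSum_apply]
    simp only [Finsupp.finsetSum_apply, Finsupp.single_apply, Prod.mk.injEq]
    by_cases hv : c.onV v = w
    · rw [Finset.sum_eq_single v]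
      · by_cases hx : (g v).eval x = ((y₀ : k) : OnePoint k)
        · simp [hv, hx, (hgood y₀ v).2 x hx]
        · simp [hx]
      · intro b _ hb
        simp [hb]
      · simp [hv]
    · rw [if_neg (by simp [hv]), Finset.sum_eq_zero]
      intro b hb
      have : b ≠ v := by
        rintro rfl
        simp [hv] at hb
      simp [this]
  rw [toGraphDivisor, hfib, Finsupp.mapDomain_finsetSum]
  refine Finset.sum_congr rfl fun v _ => ?_
  have hc : ((g v).finite_fiber (y₀ : k)).toFinset.card = Fintype.card (D v) := by
    rw [← hdeg v, ← (hgood y₀ v).1, ← Set.ncard_eq_toFinset_card _ ((g v).finite_fiber (y₀ : k))]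
    rfl
  rw [Finsupp.mapDomain_finsetSum]
  simp [Finsupp.mapDomain_single, hc]

end BalancedCover
end TropLift

/-! ### Rooted trees and legs with an additional vertex -/

namespace TropLift

namespace MetricGraph

/-- The tree with root `none`, other vertices `some n`, and an edge of length one
from each vertex `some n` to its parent; a leg is attached at `some (q l)` for each `l`.
The half of the edge of `n` which starts at `some n` is `(n, true)`. -/
def rootedTree (N L : Type u) [Fintype N] [Fintype L] (parent : N → Option N) (q : L → N)
    (hp : ∀ n, Relation.ReflTransGen (fun a b => ∃ n, a = some n ∧ b = parent n) (some n) none) :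
    MetricGraph.{u} where
  V := Option N
  H := (N × Bool) ⊕ L
  fintypeV := inferInstance
  fintypeH := inferInstance
  base := Sum.elim (fun h => if h.2 then some h.1 else parent h.1) (fun l => some (q l))
  inv := Sum.map (fun h => (h.1, !h.2)) id
  inv_inv := by rintro (h | l) <;> simp
  len := fun _ => 1
  len_pos := by simp
  len_inv := by simp
  nonempty := inferInstance
  connected := by
    have up : ∀ v : Option N, Relation.ReflTransGen
        (fun a b => ∃ n, a = some n ∧ b = parent n) v none := by
      rintro (_ | n)
      · exact Relation.ReflTransGen.refl
      · exact hp n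
    intro v w
    refine Relation.ReflTransGen.trans (b := none) ?_ ?_
    · refine Relation.ReflTransGen.mono ?_ _ _ (up v)
      rintro _ _ ⟨n, rfl, rfl⟩
      exact ⟨Sum.inl (n, true), by simp, by simp⟩
    · refine Relation.ReflTransGen.mono ?_ _ _ (Relation.ReflTransGen.swap _ _ (up w))
      rintro _ _ ⟨n, rfl, rfl⟩
      exact ⟨Sum.inl (n, false), by simp, by simp⟩

/-- Each vertex other than the root accounts for one bounded edge, the one to its parent; legs do
not count. -/
theorem firstBetti_rootedTree (N L : Type u) [Fintype N] [Fintype L] (parent : N → Option N)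
    (q : L → N) (hp) : (rootedTree N L parent q hp).firstBetti = 0 := by
  classical
  have i : {h : (rootedTree N L parent q hp).H // ¬ (rootedTree N L parent q hp).IsLeg h} ≃
      N × Bool :=
    { toFun := fun h => match h with
        | ⟨Sum.inl h, _⟩ => h
        | ⟨Sum.inr l, hl⟩ => (hl rfl).elim
      invFun := fun h => ⟨Sum.inl h, by simp [rootedTree, IsLeg, Prod.ext_iff]⟩
      left_inv := by
        rintro ⟨h | l, hl⟩
        · rfl
        · exact (hl rfl).elim
      right_inv := fun _ => rfl }
  have hV : Fintype.card (rootedTree N L parent q hp).V = Fintype.card N + 1 :=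
    Fintype.card_option (α := N)
  unfold firstBetti
  rw [hV, Fintype.card_congr i]
  simp

/-- Attach unbounded edges indexed by `J`, with an additional vertex at distance
one from the vertex to which the edge is attached. The three new half-edges of the edge `j` are
`Sum.inl (Sum.inr j)` at the old vertex, and at the new vertex `Sum.inr (Sum.inl j)`, which is
opposite to it, and the leg `Sum.inr (Sum.inr j)`. -/
def attachSubdividedLegs (Γ : MetricGraph.{u}) (J : Type u) [Fintype J] (p : J → Γ.V) :
    MetricGraph.{u} where
  V := Γ.V ⊕ J
  H := (Γ.H ⊕ J) ⊕ (J ⊕ J)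
  fintypeV := inferInstance
  fintypeH := inferInstance
  base := Sum.elim (Sum.elim (fun h => Sum.inl (Γ.base h)) (fun j => Sum.inl (p j)))
    (Sum.elim Sum.inr Sum.inr)
  inv := Sum.elim (Sum.elim (fun h => Sum.inl (Sum.inl (Γ.inv h))) (fun j => Sum.inr (Sum.inl j)))
    (Sum.elim (fun j => Sum.inl (Sum.inr j)) (fun j => Sum.inr (Sum.inr j)))
  inv_inv := by rintro ((h | j) | j | j) <;> simp [Γ.inv_inv]
  len := Sum.elim (Sum.elim Γ.len fun _ => 1) (fun _ => 1)
  len_pos := by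
    rintro ((h | j) | j | j) hh
    · exact Γ.len_pos h (fun h' => hh (by simp [h']))
    all_goals simp
  len_inv := by rintro ((h | j) | j | j) <;> simp [Γ.len_inv]
  nonempty := inferInstance
  connected := by
    set B : (Γ.H ⊕ J) ⊕ (J ⊕ J) → Γ.V ⊕ J :=
      Sum.elim (Sum.elim (fun h => Sum.inl (Γ.base h)) (fun j => Sum.inl (p j)))
        (Sum.elim Sum.inr Sum.inr) with hB
    set I : (Γ.H ⊕ J) ⊕ (J ⊕ J) → (Γ.H ⊕ J) ⊕ (J ⊕ J) :=
      Sum.elim (Sum.elim (fun h => Sum.inl (Sum.inl (Γ.inv h))) (fun j => Sum.inr (Sum.inl j)))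
        (Sum.elim (fun j => Sum.inl (Sum.inr j)) (fun j => Sum.inr (Sum.inr j))) with hI
    have main : ∀ a b : Γ.V, Relation.ReflTransGen (fun a b => ∃ h, B h = a ∧ B (I h) = b)
        (Sum.inl a) (Sum.inl b) := by
      intro a b
      refine Relation.ReflTransGen.lift Sum.inl ?_ a b (Γ.connected a b)
      rintro _ _ ⟨h, rfl, rfl⟩
      exact ⟨Sum.inl (Sum.inl h), rfl, rfl⟩
    rintro (a | j) (b | j')
    · exact main a b
    · exact (main a (p j')).tail ⟨Sum.inl (Sum.inr j'), rfl, rfl⟩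
    · exact (main (p j) b).head ⟨Sum.inr (Sum.inl j), rfl, rfl⟩
    · exact ((main (p j) (p j')).tail ⟨Sum.inl (Sum.inr j'), rfl, rfl⟩).head
        ⟨Sum.inr (Sum.inl j), rfl, rfl⟩

/-- Glue the legs and subdivide each at distance one. The result has the set `S` of new half-edges
as index set, and an isomorphism relabels it by `J`. -/
theorem IsTropicalModification.attachSubdividedLegs {Γ Γ' : MetricGraph.{u}} {ι : Γ.V → Γ'.V}
    (h : IsTropicalModification Γ Γ' ι) (J : Type u) [Fintype J] (p : J → Γ'.V) :
    IsTropicalModification Γ (Γ'.attachSubdividedLegs J p) (fun v => Sum.inl (ι v)) := by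
  classical
  set S : Finset (Γ'.attachLegs J p).H := Finset.univ.map ⟨Sum.inr, Sum.inr_injective⟩ with hS
  have hmem : ∀ j : J, (Sum.inr j : (Γ'.attachLegs J p).H) ∈ S := fun j =>
    Finset.mem_map.2 ⟨j, Finset.mem_univ _, rfl⟩
  have hnot : ∀ h : Γ'.H, (Sum.inl h : (Γ'.attachLegs J p).H) ∉ S := fun h hh => by
    obtain ⟨j, -, hj⟩ := Finset.mem_map.1 hh
    exact Sum.inr_ne_inl hj
  have hleg : ∀ h ∈ S, (Γ'.attachLegs J p).IsLeg h := by
    intro h hh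
    obtain ⟨j, -, rfl⟩ := Finset.mem_map.1 hh
    rfl
  let i : J ≃ S := Equiv.ofBijective (fun j => ⟨Sum.inr j, hmem j⟩) (by
    constructor
    · intro a b hab
      exact Sum.inr_injective (congrArg Subtype.val hab)
    · rintro ⟨h, hh⟩
      obtain ⟨j, -, rfl⟩ := Finset.mem_map.1 hh
      exact ⟨j, rfl⟩)
  have hi : ∀ j, i j = ⟨Sum.inr j, hmem j⟩ := fun _ => rfl
  have hsub := (h.attachLegs J p).subdivide S (fun _ => 1) (fun h hh _ => hleg h hh)
    (fun _ _ => one_pos) (fun h hh hh' => (hh' (hleg h hh)).elim)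
  have hI1 : ∀ h : Γ'.H, (Γ'.attachLegs J p).subdivideInv S (Sum.inl (Sum.inl h)) =
      Sum.inl (Sum.inl (Γ'.inv h)) := fun h =>
    (dif_neg (hnot h)).trans (dif_neg (hnot (Γ'.inv h)))
  have hI2 : ∀ j : J, (Γ'.attachLegs J p).subdivideInv S (Sum.inl (Sum.inr j)) =
      Sum.inr (Sum.inl (i j)) := fun j => dif_pos (hmem j)
  have hI3 : ∀ j : J, (Γ'.attachLegs J p).subdivideInv S (Sum.inr (Sum.inl (i j))) =
      Sum.inl (Sum.inr j) := fun j => rfl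
  have hI4 : ∀ j : J, (Γ'.attachLegs J p).subdivideInv S (Sum.inr (Sum.inr (i j))) =
      Sum.inr (Sum.inr (i j)) := fun j => if_pos rfl
  let iV : Γ'.V ⊕ S ≃ Γ'.V ⊕ J := Equiv.sumCongr (Equiv.refl _) i.symm
  let iH : (Γ'.H ⊕ J) ⊕ (S ⊕ S) ≃ (Γ'.H ⊕ J) ⊕ (J ⊕ J) :=
    Equiv.sumCongr (Equiv.refl _) (Equiv.sumCongr i.symm i.symm)
  refine IsTropicalModification.iso (Γ'' := Γ'.attachSubdividedLegs J p) hsub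
    { onV := iV
      onH := iH
      base_onH := ?_
      inv_onH := ?_
      len_onH := ?_ }
  · rintro ((h | j) | s | s) <;> rfl
  · rintro ((h | j) | s | s)
    · exact congrArg iH (hI1 h).symm
    · refine Eq.trans ?_
        (congrArg iH (hI2 j).symm)
      exact congrArg (fun j => Sum.inr (Sum.inl j)) (i.symm_apply_apply j).symm
    · obtain ⟨j, rfl⟩ := i.surjective s
      refine Eq.trans ?_
        (congrArg iH (hI3 j).symm)
      exact congrArg (fun j => Sum.inl (Sum.inr j)) (i.symm_apply_apply j)
    · obtain ⟨j, rfl⟩ := i.surjective s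
      refine Eq.trans ?_
        (congrArg iH (hI4 j).symm)
      rfl
  · rintro ((h | j) | s | s) hh
    · exact ((if_neg (hnot h)).trans (if_neg (hnot (Γ'.inv h)))).symm
    · exact (if_pos (hmem j)).symm
    · rfl
    · obtain ⟨j, rfl⟩ := i.surjective s
      exact (hh (hI4 j)).elim

end MetricGraph
end TropLift

/-! ### The projection from an element: source, target and map -/

namespace TropLift
namespace RankThreeSimpleMatroid

variable {E : Type u} [Fintype E] (M : RankThreeSimpleMatroid E) (e : E)

/-- The type of flats of `M`. -/
abbrev Flat : Type u := {f : Finset E // f ∈ M.flats}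

variable {M} in
theorem flat_eq {a b : E} (h : a ≠ b) {f g : M.Flat} (ha : a ∈ f.1) (hb : b ∈ f.1)
    (ha' : a ∈ g.1) (hb' : b ∈ g.1) : f = g :=
  Subtype.ext ((M.existsUnique_flat a b h).unique ⟨f.2, ha, hb⟩ ⟨g.2, ha', hb'⟩)

theorem exists_flat {a b : E} (h : a ≠ b) : ∃ f : M.Flat, a ∈ f.1 ∧ b ∈ f.1 := by
  obtain ⟨f, ⟨hf, h1, h2⟩, -⟩ := M.existsUnique_flat a b h
  exact ⟨⟨f, hf⟩, h1, h2⟩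

theorem exists_mem_ne (f : M.Flat) : ∃ a, a ∈ f.1 ∧ a ≠ e :=
  Finset.exists_mem_ne (M.two_le_card_of_mem f.1 f.2) e

theorem exists_element_ne (M : RankThreeSimpleMatroid E) (e : E) : ∃ a : E, a ≠ e := by
  obtain ⟨f, hf⟩ := Finset.card_pos.1 (lt_of_lt_of_le Nat.zero_lt_two M.two_le_card_flats)
  obtain ⟨a, -, h⟩ := M.exists_mem_ne e ⟨f, hf⟩
  exact ⟨a, h⟩

theorem exists_flat_mem (M : RankThreeSimpleMatroid E) (e : E) : ∃ f : M.Flat, e ∈ f.1 := by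
  obtain ⟨a, h⟩ := M.exists_element_ne e
  obtain ⟨f, -, hf⟩ := M.exists_flat h
  exact ⟨f, hf⟩

/-- An element of the flat `f` other than `e`. -/
noncomputable def other (f : M.Flat) : E := (M.exists_mem_ne e f).choose

theorem other_mem (f : M.Flat) : M.other e f ∈ f.1 := (M.exists_mem_ne e f).choose_spec.1

theorem other_ne (f : M.Flat) : M.other e f ≠ e := (M.exists_mem_ne e f).choose_spec.2

/-- The leaves of the tree `projectionTree`: `none` is the image of `e`, and the other leaves are
the images of the flats that do not contain `e`. -/
abbrev Leaf : Type u := Option {f : M.Flat // e ∉ f.1}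

/-- The vertices of the tree `projectionTree` other than its root: the leaves, and `none`, which is
the image of the flats containing `e`. -/
abbrev Node : Type u := Option (M.Leaf e)

/-- The parent of a node of the tree `projectionTree`. -/
def parent : M.Node e → Option (M.Node e)
  | none => none
  | some none => some none
  | some (some _) => none

theorem reflTransGen_parent (n : M.Node e) :
    Relation.ReflTransGen (fun a b => ∃ n, a = some n ∧ b = M.parent e n) (some n) none := by
  rcases n with _ | _ | f
  · exact Relation.ReflTransGen.single ⟨none, rfl, rfl⟩
  · exact (Relation.ReflTransGen.single ⟨none, rfl, rfl⟩).head ⟨some none, rfl, rfl⟩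
  · exact Relation.ReflTransGen.single ⟨some (some f), rfl, rfl⟩

open scoped Classical in
/-- The target of the projection of the Levi graph from `e`. The elements other than `e` map to
the root. -/
noncomputable def projectionTree : MetricGraph.{u} :=
  rootedTree (M.Node e) (M.Leaf e) (M.parent e) some (M.reflTransGen_parent e)

open scoped Classical in
theorem firstBetti_projectionTree : (M.projectionTree e).firstBetti = 0 :=
  firstBetti_rootedTree _ _ _ _ _

/-- The antiflags away from `e`. -/
abbrev Antiflag : Type u := {p : E × M.Flat // p.1 ≠ e ∧ e ∉ p.2.1 ∧ p.1 ∉ p.2.1}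

/-- The flags with flat through `e` and element different from both `e` and the chosen
element `other`. -/
abbrev ExtraFlag : Type u :=
  {p : E × M.Flat // e ∈ p.2.1 ∧ p.1 ∈ p.2.1 ∧ p.1 ≠ e ∧ p.1 ≠ M.other e p.2}

/-- The flags whose flat does not contain `e`. -/
abbrev OuterFlag : Type u := {p : E × M.Flat // p.1 ∈ p.2.1 ∧ e ∉ p.2.1}

/-- The flats containing `e`. -/
abbrev Pencil : Type u := {f : M.Flat // e ∈ f.1}

noncomputable instance : Fintype (M.Antiflag e) := Fintype.ofFinite _

noncomputable instance : Fintype (M.ExtraFlag e) := Fintype.ofFinite _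

noncomputable instance : Fintype (M.OuterFlag e) := Fintype.ofFinite _

noncomputable instance : Fintype (M.Pencil e) := Fintype.ofFinite _

/-- The vertices of the modification of the Levi graph. -/
abbrev ModV : Type u := (E ⊕ M.Flat) ⊕ (M.Antiflag e ⊕ M.ExtraFlag e)

/-- The half-edges of the modification of the Levi graph. -/
abbrev ModH : Type u :=
  (((M.Flag × Bool) ⊕ (M.Antiflag e ⊕ M.ExtraFlag e)) ⊕
    ((M.Antiflag e ⊕ M.ExtraFlag e) ⊕ (M.Antiflag e ⊕ M.ExtraFlag e))) ⊕
    (M.OuterFlag e ⊕ M.Pencil e)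

/-- The modification of the Levi graph which is the source of the projection from `e`. -/
noncomputable def modification : MetricGraph.{u} :=
  (M.leviGraph.attachSubdividedLegs (M.Antiflag e ⊕ M.ExtraFlag e)
    (Sum.elim (fun p => (Sum.inl p.1.1 : E ⊕ M.Flat))
      (fun p => (Sum.inr p.1.2 : E ⊕ M.Flat)))).attachLegs
    (M.OuterFlag e ⊕ M.Pencil e)
    (Sum.elim (fun p => (Sum.inl (Sum.inr p.1.2) : M.ModV e)) (fun _ => Sum.inl (Sum.inl e)))

/-- There are two kinds of glued edges. Those for antiflags and extra flags start over an inner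
vertex of the tree and run along a bounded edge to a leaf before going to infinity, hence their
additional vertex at distance one. Those for outer flags and for the pencil already start over a
leaf. -/
theorem isTropicalModification_modification :
    IsTropicalModification M.leviGraph (M.modification e) Sum.inl :=
  (IsTropicalModification.refl.attachSubdividedLegs _ _).attachLegs _ _

/-- The half-edges at `v` above a given direction are indexed by `Sheet v`. -/
def Sheet : M.ModV e → Type u
  | Sum.inl (Sum.inl a) => {f : M.Flat // e ∈ f.1 ∧ a ∈ f.1}
  | Sum.inl (Sum.inr f) => {a : E // a ∈ f.1 ∧ a ≠ e}
  | Sum.inr _ => PUnit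

instance finite_sheet (v : M.ModV e) : Finite (M.Sheet e v) := by
  rcases v with (a | f) | j
  · exact inferInstanceAs (Finite {f : M.Flat // e ∈ f.1 ∧ a ∈ f.1})
  · exact inferInstanceAs (Finite {a : E // a ∈ f.1 ∧ a ≠ e})
  · exact inferInstanceAs (Finite PUnit)

theorem nonempty_sheet_element (a : E) : Nonempty {f : M.Flat // e ∈ f.1 ∧ a ∈ f.1} := by
  by_cases h : e = a
  · subst h
    obtain ⟨f, hf⟩ := M.exists_flat_mem e
    exact ⟨⟨f, hf, hf⟩⟩
  · obtain ⟨f, hf⟩ := M.exists_flat h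
    exact ⟨⟨f, hf⟩⟩

/-- The flat spanned by `a` and `e` is unique. This gives local degree 1, hence coefficient 1 in the
fiber. -/
theorem subsingleton_sheet_element {a : E} (h : a ≠ e) :
    Subsingleton {f : M.Flat // e ∈ f.1 ∧ a ∈ f.1} :=
  ⟨fun f g => Subtype.ext (flat_eq h f.2.2 f.2.1 g.2.2 g.2.1)⟩

instance nonempty_sheet (v : M.ModV e) : Nonempty (M.Sheet e v) := by
  rcases v with (a | f) | j
  · exact M.nonempty_sheet_element e a
  · obtain ⟨a, ha⟩ := M.exists_mem_ne e f
    exact ⟨⟨a, ha⟩⟩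
  · exact ⟨PUnit.unit⟩

/-- The leaf to which a new vertex of the modification is projected. -/
def leafOf : M.Antiflag e ⊕ M.ExtraFlag e → M.Leaf e :=
  Sum.elim (fun p => some ⟨p.1.2, p.2.2.1⟩) (fun _ => none)

open scoped Classical in
/-- The projection from `e` on the vertices. -/
noncomputable def projV : M.ModV e → Option (M.Node e)
  | Sum.inl (Sum.inl a) => if a = e then some (some none) else none
  | Sum.inl (Sum.inr f) => if h : e ∈ f.1 then some none else some (some (some ⟨f, h⟩))
  | Sum.inr j => some (some (M.leafOf e j))

open scoped Classical in
/-- The projection from `e` on the half-edges. -/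
noncomputable def projH : M.ModH e → (M.Node e × Bool) ⊕ M.Leaf e
  | Sum.inl (Sum.inl (Sum.inl (x, b))) =>
      -- The side is flipped because `e` lies farther from the root than its flats, whereas every
      -- other element lies closer to the root than its flats.
      if x.1.1 = e then Sum.inl (some none, !b)
      else if h : e ∈ x.1.2.1 then Sum.inl (none, b)
      else Sum.inl (some (some ⟨x.1.2, h⟩), b)
  | Sum.inl (Sum.inl (Sum.inr j)) => Sum.inl (some (M.leafOf e j), false)
  | Sum.inl (Sum.inr (Sum.inl j)) => Sum.inl (some (M.leafOf e j), true)
  | Sum.inl (Sum.inr (Sum.inr j)) => Sum.inr (M.leafOf e j)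
  | Sum.inr (Sum.inl p) => Sum.inr (some ⟨p.1.2, p.2.2⟩)
  | Sum.inr (Sum.inr _) => Sum.inr none

/-- The vertex at which a half-edge of the modification starts. -/
noncomputable def modBase : M.ModH e → M.ModV e := (M.modification e).base

/-- The vertex at which a half-edge of the tree starts. -/
noncomputable def treeBase : (M.Node e × Bool) ⊕ M.Leaf e → Option (M.Node e) :=
  (M.projectionTree e).base

section simp_lemmas

variable {M e}

theorem projV_self : M.projV e (Sum.inl (Sum.inl e)) = some (some none) := by simp [projV]

theorem projV_element {a : E} (h : a ≠ e) : M.projV e (Sum.inl (Sum.inl a)) = none := by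
  simp [projV, h]

theorem projV_flat_mem {f : M.Flat} (h : e ∈ f.1) :
    M.projV e (Sum.inl (Sum.inr f)) = some none := by simp [projV, h]

theorem projV_flat_not_mem {f : M.Flat} (h : e ∉ f.1) :
    M.projV e (Sum.inl (Sum.inr f)) = some (some (some ⟨f, h⟩)) := by simp [projV, h]

theorem projH_self {x : M.Flag} (b : Bool) (h : x.1.1 = e) :
    M.projH e (Sum.inl (Sum.inl (Sum.inl (x, b)))) = Sum.inl (some none, !b) := by
  simp [projH, h]

theorem projH_mem {x : M.Flag} (b : Bool) (h : x.1.1 ≠ e) (h' : e ∈ x.1.2.1) :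
    M.projH e (Sum.inl (Sum.inl (Sum.inl (x, b)))) = Sum.inl (none, b) := by
  simp [projH, h, h']

theorem projH_not_mem {x : M.Flag} (b : Bool) (h' : e ∉ x.1.2.1) :
    M.projH e (Sum.inl (Sum.inl (Sum.inl (x, b)))) = Sum.inl (some (some ⟨x.1.2, h'⟩), b) := by
  have h : x.1.1 ≠ e := fun h => h' (h ▸ x.2)
  simp [projH, h, h']

end simp_lemmas

theorem base_projH (h : M.ModH e) :
    M.treeBase e (M.projH e h) = M.projV e (M.modBase e h) := by
  rcases h with (((⟨x, b⟩ | j) | j | j) | (p | p))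
  · by_cases h1 : x.1.1 = e
    · have h2 : e ∈ x.1.2.1 := h1 ▸ x.2
      rw [projH_self b h1]
      cases b
      · refine Eq.trans ?_ (congrArg (fun a => M.projV e (Sum.inl (Sum.inl a))) h1.symm)
        exact projV_self.symm
      · exact (projV_flat_mem h2).symm
    · by_cases h2 : e ∈ x.1.2.1
      · rw [projH_mem b h1 h2]
        cases b
        · exact (projV_element h1).symm
        · exact (projV_flat_mem h2).symm
      · rw [projH_not_mem b h2]
        cases b
        · exact (projV_element h1).symm
        · exact (projV_flat_not_mem h2).symm
  · rcases j with p | p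
    · exact (projV_element p.2.1).symm
    · exact (projV_flat_mem p.2.1).symm
  · rfl
  · rfl
  · exact (projV_flat_not_mem p.2.2).symm
  · exact projV_self.symm

theorem nonempty_equiv_of_forall {H V T D : Type*} {base : H → V} {p : H → T} {v : V} {t : T}
    (F : D → H) (hF : F.Injective) (hb : ∀ d, base (F d) = v) (hp : ∀ d, p (F d) = t)
    (hs : ∀ h, base h = v → p h = t → ∃ d, F d = h) :
    Nonempty ({h : H // base h = v ∧ p h = t} ≃ D) := by
  refine ⟨(Equiv.ofBijective (fun d => ⟨F d, hb d, hp d⟩) ⟨?_, ?_⟩).symm⟩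
  · intro a b hab
    exact hF (congrArg Subtype.val hab)
  · rintro ⟨h, h1, h2⟩
    obtain ⟨d, hd⟩ := hs h h1 h2
    exact ⟨d, Subtype.ext hd⟩

end RankThreeSimpleMatroid
end TropLift

/-! ### Counting the half-edges above each direction -/

namespace TropLift
namespace RankThreeSimpleMatroid

variable {E : Type u} [Fintype E] {M : RankThreeSimpleMatroid E} {e : E}

@[simp] theorem modBase_flag_false (x : M.Flag) :
    M.modBase e (Sum.inl (Sum.inl (Sum.inl (x, false)))) = Sum.inl (Sum.inl x.1.1) := rfl

@[simp] theorem modBase_flag_true (x : M.Flag) :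
    M.modBase e (Sum.inl (Sum.inl (Sum.inl (x, true)))) = Sum.inl (Sum.inr x.1.2) := rfl

@[simp] theorem modBase_antiflag (p : M.Antiflag e) :
    M.modBase e (Sum.inl (Sum.inl (Sum.inr (Sum.inl p)))) = Sum.inl (Sum.inl p.1.1) := rfl

@[simp] theorem modBase_extraFlag (p : M.ExtraFlag e) :
    M.modBase e (Sum.inl (Sum.inl (Sum.inr (Sum.inr p)))) = Sum.inl (Sum.inr p.1.2) := rfl

@[simp] theorem modBase_back (j : M.Antiflag e ⊕ M.ExtraFlag e) :
    M.modBase e (Sum.inl (Sum.inr (Sum.inl j))) = Sum.inr j := rfl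

@[simp] theorem modBase_leg (j : M.Antiflag e ⊕ M.ExtraFlag e) :
    M.modBase e (Sum.inl (Sum.inr (Sum.inr j))) = Sum.inr j := rfl

@[simp] theorem modBase_outerFlag (p : M.OuterFlag e) :
    M.modBase e (Sum.inr (Sum.inl p)) = Sum.inl (Sum.inr p.1.2) := rfl

@[simp] theorem modBase_pencil (p : M.Pencil e) :
    M.modBase e (Sum.inr (Sum.inr p)) = Sum.inl (Sum.inl e) := rfl

theorem projH_flag (x : M.Flag) (b : Bool) :
    (x.1.1 = e ∧ M.projH e (Sum.inl (Sum.inl (Sum.inl (x, b)))) = Sum.inl (some none, !b)) ∨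
    (x.1.1 ≠ e ∧ e ∈ x.1.2.1 ∧
      M.projH e (Sum.inl (Sum.inl (Sum.inl (x, b)))) = Sum.inl (none, b)) ∨
    (x.1.1 ≠ e ∧ ∃ h : e ∉ x.1.2.1,
      M.projH e (Sum.inl (Sum.inl (Sum.inl (x, b)))) = Sum.inl (some (some ⟨x.1.2, h⟩), b)) := by
  by_cases h : x.1.1 = e
  · exact Or.inl ⟨h, projH_self b h⟩
  · by_cases h' : e ∈ x.1.2.1
    · exact Or.inr (Or.inl ⟨h, h', projH_mem b h h'⟩)
    · exact Or.inr (Or.inr ⟨h, h', projH_not_mem b h'⟩)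

@[simp] theorem projH_antiflag (p : M.Antiflag e) :
    M.projH e (Sum.inl (Sum.inl (Sum.inr (Sum.inl p)))) =
      Sum.inl (some (some ⟨p.1.2, p.2.2.1⟩), false) := rfl

@[simp] theorem projH_extraFlag (p : M.ExtraFlag e) :
    M.projH e (Sum.inl (Sum.inl (Sum.inr (Sum.inr p)))) = Sum.inl (some none, false) := rfl

@[simp] theorem projH_back (j : M.Antiflag e ⊕ M.ExtraFlag e) :
    M.projH e (Sum.inl (Sum.inr (Sum.inl j))) = Sum.inl (some (M.leafOf e j), true) := rfl

@[simp] theorem projH_leg (j : M.Antiflag e ⊕ M.ExtraFlag e) :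
    M.projH e (Sum.inl (Sum.inr (Sum.inr j))) = Sum.inr (M.leafOf e j) := rfl

@[simp] theorem projH_outerFlag (p : M.OuterFlag e) :
    M.projH e (Sum.inr (Sum.inl p)) = Sum.inr (some ⟨p.1.2, p.2.2⟩) := rfl

@[simp] theorem projH_pencil (p : M.Pencil e) :
    M.projH e (Sum.inr (Sum.inr p)) = Sum.inr none := rfl

/-- The half-edges at `v` above the direction `t`. -/
abbrev Above (M : RankThreeSimpleMatroid E) (e : E) (v : M.ModV e)
    (t : (M.Node e × Bool) ⊕ M.Leaf e) : Type u :=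
  {h : M.ModH e // M.modBase e h = v ∧ M.projH e h = t}

theorem above_element_pencil {a : E} (ha : a ≠ e) :
    Nonempty (M.Above e (Sum.inl (Sum.inl a)) (Sum.inl (none, false)) ≃
      M.Sheet e (Sum.inl (Sum.inl a))) := by
  refine nonempty_equiv_of_forall (D := {f : M.Flat // e ∈ f.1 ∧ a ∈ f.1})
    (fun d => Sum.inl (Sum.inl (Sum.inl (⟨(a, d.1), d.2.2⟩, false)))) ?_ ?_ ?_ ?_
  · rintro ⟨d, _⟩ ⟨d', _⟩ h
    cases h
    rfl
  · intro d
    rfl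
  · intro d
    exact projH_mem _ ha d.2.1
  · rintro (((⟨⟨⟨a', f⟩, hx⟩, _ | _⟩ | p | p) | j | j) | p | p) h1 h2 <;> simp at h1 h2
    subst h1
    obtain ⟨h, -⟩ | ⟨h, h3, h4⟩ | ⟨h, h3, h4⟩ := projH_flag (e := e) ⟨(a', f), hx⟩ false
    · exact (ha h).elim
    · exact ⟨⟨f, h3, hx⟩, rfl⟩
    · rw [h2] at h4
      simp at h4

/-- Exactly one half-edge is needed. It is the flag `(a, f)` if `a` lies on `f`, and otherwise the
edge glued for the antiflag. -/
theorem above_element_flat {a : E} (ha : a ≠ e) (f : M.Flat) (hf : e ∉ f.1) :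
    Nonempty (M.Above e (Sum.inl (Sum.inl a)) (Sum.inl (some (some ⟨f, hf⟩), false)) ≃
      M.Sheet e (Sum.inl (Sum.inl a))) := by
  have hsub := M.subsingleton_sheet_element e ha
  obtain ⟨d⟩ := M.nonempty_sheet_element e a
  by_cases haf : a ∈ f.1
  · refine nonempty_equiv_of_forall (D := {f : M.Flat // e ∈ f.1 ∧ a ∈ f.1})
      (fun _ => Sum.inl (Sum.inl (Sum.inl (⟨(a, f), haf⟩, false))))
      (fun _ _ _ => Subsingleton.elim _ _) (fun _ => rfl) (fun _ => projH_not_mem _ hf) ?_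
    rintro (((⟨⟨⟨a', g⟩, hx⟩, _ | _⟩ | p | p) | j | j) | p | p) h1 h2 <;> simp at h1 h2
    · subst h1
      refine ⟨d, ?_⟩
      obtain ⟨h, -⟩ | ⟨h, h3, h4⟩ | ⟨h, h3, h4⟩ := projH_flag (e := e) ⟨(a', g), hx⟩ false
      · exact (ha h).elim
      all_goals
        rw [h2] at h4
        simp at h4
      simp [h4]
    · exact (p.2.2.2 (h1 ▸ h2 ▸ haf)).elim
  · refine nonempty_equiv_of_forall (D := {f : M.Flat // e ∈ f.1 ∧ a ∈ f.1})
      (fun _ => Sum.inl (Sum.inl (Sum.inr (Sum.inl ⟨(a, f), ha, hf, haf⟩))))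
      (fun _ _ _ => Subsingleton.elim _ _) (fun _ => rfl) (fun _ => rfl) ?_
    rintro (((⟨⟨⟨a', g⟩, hx⟩, _ | _⟩ | ⟨⟨a', g⟩, p⟩ | p) | j | j) | p | p) h1 h2 <;> simp at h1 h2
    · subst h1
      obtain ⟨h, -⟩ | ⟨h, h3, h4⟩ | ⟨h, h3, h4⟩ := projH_flag (e := e) ⟨(a', g), hx⟩ false
      · exact (ha h).elim
      all_goals
        rw [h2] at h4
        simp at h4
      exact (haf (h4 ▸ hx)).elim
    · subst h1 h2
      exact ⟨d, rfl⟩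

theorem above_self_edge :
    Nonempty (M.Above e (Sum.inl (Sum.inl e)) (Sum.inl (some none, true)) ≃
      M.Sheet e (Sum.inl (Sum.inl e))) := by
  refine nonempty_equiv_of_forall (D := {f : M.Flat // e ∈ f.1 ∧ e ∈ f.1})
    (fun d => Sum.inl (Sum.inl (Sum.inl (⟨(e, d.1), d.2.2⟩, false)))) ?_ ?_ ?_ ?_
  · rintro ⟨d, _⟩ ⟨d', _⟩ h
    cases h
    rfl
  · intro d
    rfl
  · intro d
    exact projH_self _ rfl
  · rintro (((⟨⟨⟨a', f⟩, hx⟩, _ | _⟩ | p | p) | j | j) | p | p) h1 h2 <;> simp at h1 h2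
    subst h1
    exact ⟨⟨f, hx, hx⟩, rfl⟩

/-- The pencil legs balance the edges from `e` to the flats through it, one for one. -/
theorem above_self_leg :
    Nonempty (M.Above e (Sum.inl (Sum.inl e)) (Sum.inr none) ≃
      M.Sheet e (Sum.inl (Sum.inl e))) := by
  refine nonempty_equiv_of_forall (D := {f : M.Flat // e ∈ f.1 ∧ e ∈ f.1})
    (fun d => Sum.inr (Sum.inr ⟨d.1, d.2.1⟩)) ?_ (fun _ => rfl) (fun _ => rfl) ?_
  · rintro ⟨d, _⟩ ⟨d', _⟩ h
    cases h
    rfl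
  · rintro (((⟨⟨⟨a', f⟩, hx⟩, _ | _⟩ | p | p) | j | j) | p | p) h1 h2 <;> simp at h1 h2
    · obtain ⟨h, h4⟩ | ⟨h, h3, h4⟩ | ⟨h, h3, h4⟩ := projH_flag (e := e) ⟨(a', f), hx⟩ false <;>
      · rw [h2] at h4
        simp at h4
    · exact ⟨⟨p.1, p.2, p.2⟩, rfl⟩

theorem above_pencil_up (f : M.Flat) (hf : e ∈ f.1) :
    Nonempty (M.Above e (Sum.inl (Sum.inr f)) (Sum.inl (none, true)) ≃
      M.Sheet e (Sum.inl (Sum.inr f))) := by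
  refine nonempty_equiv_of_forall (D := {a : E // a ∈ f.1 ∧ a ≠ e})
    (fun d => Sum.inl (Sum.inl (Sum.inl (⟨(d.1, f), d.2.1⟩, true)))) ?_ (fun _ => rfl)
    (fun d => projH_mem _ d.2.2 hf) ?_
  · rintro ⟨d, _⟩ ⟨d', _⟩ h
    cases h
    rfl
  · rintro (((⟨⟨⟨a, g⟩, hx⟩, _ | _⟩ | p | p) | j | j) | p | p) h1 h2 <;> simp at h1 h2
    subst h1
    obtain ⟨h, h4⟩ | ⟨h, h3, h4⟩ | ⟨h, h3, h4⟩ := projH_flag (e := e) ⟨(a, g), hx⟩ true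
    · rw [h2] at h4
      simp at h4
    · exact ⟨⟨a, hx, h⟩, rfl⟩
    · exact (h3 hf).elim

-- Towards `e` the flat has a single Levi edge, but `|f| - 1` are required. The chosen element
-- `other` takes this edge, and each remaining element different from `e` takes the edge glued for
-- its extra flag.
open scoped Classical in
theorem above_pencil_down (f : M.Flat) (hf : e ∈ f.1) :
    Nonempty (M.Above e (Sum.inl (Sum.inr f)) (Sum.inl (some none, false)) ≃
      M.Sheet e (Sum.inl (Sum.inr f))) := by
  refine nonempty_equiv_of_forall (D := {a : E // a ∈ f.1 ∧ a ≠ e})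
    (fun d => if h : d.1 = M.other e f then Sum.inl (Sum.inl (Sum.inl (⟨(e, f), hf⟩, true)))
      else Sum.inl (Sum.inl (Sum.inr (Sum.inr ⟨(d.1, f), hf, d.2.1, d.2.2, h⟩)))) ?_ ?_ ?_ ?_
  · rintro ⟨d, _⟩ ⟨d', _⟩ h
    dsimp only at h
    split_ifs at h with h1 h2
    · exact Subtype.ext (h1.trans h2.symm)
    · simp at h
    · simp at h
    · cases h
      rfl
  · intro d
    split_ifs <;> rfl
  · intro d
    split_ifs
    · exact projH_self _ rfl
    · rfl
  · rintro (((⟨⟨⟨a, g⟩, hx⟩, _ | _⟩ | p | ⟨⟨a, g⟩, p⟩) | j | j) | p | p) h1 h2 <;> simp at h1 h2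
    · subst h1
      refine ⟨⟨M.other e g, M.other_mem e g, M.other_ne e g⟩, ?_⟩
      obtain ⟨h, h4⟩ | ⟨h, h3, h4⟩ | ⟨h, h3, h4⟩ := projH_flag (e := e) ⟨(a, g), hx⟩ true
      · simpa using h.symm
      all_goals
        rw [h2] at h4
        simp at h4
    · subst h1
      exact ⟨⟨a, p.2.1, p.2.2.1⟩, dif_neg p.2.2.2⟩

theorem above_flat_up (f : M.Flat) (hf : e ∉ f.1) :
    Nonempty (M.Above e (Sum.inl (Sum.inr f)) (Sum.inl (some (some ⟨f, hf⟩), true)) ≃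
      M.Sheet e (Sum.inl (Sum.inr f))) := by
  refine nonempty_equiv_of_forall (D := {a : E // a ∈ f.1 ∧ a ≠ e})
    (fun d => Sum.inl (Sum.inl (Sum.inl (⟨(d.1, f), d.2.1⟩, true)))) ?_ (fun _ => rfl)
    (fun d => projH_not_mem _ hf) ?_
  · rintro ⟨d, _⟩ ⟨d', _⟩ h
    cases h
    rfl
  · rintro (((⟨⟨⟨a, g⟩, hx⟩, _ | _⟩ | p | p) | j | j) | p | p) h1 h2 <;> simp at h1 h2
    subst h1
    exact ⟨⟨a, hx, fun h => hf (h ▸ hx)⟩, rfl⟩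

/-- One outer leg is glued for each element of the flat, to match the Levi edges on the side of the
root. The condition `a ≠ e` in the sheets is automatic here, as `e` is not on `f`. -/
theorem above_flat_leg (f : M.Flat) (hf : e ∉ f.1) :
    Nonempty (M.Above e (Sum.inl (Sum.inr f)) (Sum.inr (some ⟨f, hf⟩)) ≃
      M.Sheet e (Sum.inl (Sum.inr f))) := by
  refine nonempty_equiv_of_forall (D := {a : E // a ∈ f.1 ∧ a ≠ e})
    (fun d => Sum.inr (Sum.inl ⟨(d.1, f), d.2.1, hf⟩)) ?_ (fun _ => rfl) (fun _ => rfl) ?_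
  · rintro ⟨d, _⟩ ⟨d', _⟩ h
    cases h
    rfl
  · rintro (((⟨⟨⟨a, g⟩, hx⟩, _ | _⟩ | p | p) | j | j) | ⟨⟨a, g⟩, p⟩ | p) h1 h2 <;> simp at h1 h2
    · obtain ⟨h, h4⟩ | ⟨h, h3, h4⟩ | ⟨h, h3, h4⟩ := projH_flag (e := e) ⟨(a, g), hx⟩ true <;>
      · rw [h2] at h4
        simp at h4
    · subst h1
      exact ⟨⟨a, p.1, fun h => hf (h ▸ p.1)⟩, rfl⟩

theorem above_new_up (j : M.Antiflag e ⊕ M.ExtraFlag e) :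
    Nonempty (M.Above e (Sum.inr j) (Sum.inl (some (M.leafOf e j), true)) ≃
      M.Sheet e (Sum.inr j)) := by
  refine nonempty_equiv_of_forall (D := PUnit) (fun _ => Sum.inl (Sum.inr (Sum.inl j)))
    (fun _ _ _ => rfl) (fun _ => rfl) (fun _ => rfl) ?_
  rintro (((⟨x, _ | _⟩ | p | p) | j' | j') | p | p) h1 h2 <;> simp at h1 h2
  exact ⟨PUnit.unit, by rw [h1]⟩

theorem above_new_leg (j : M.Antiflag e ⊕ M.ExtraFlag e) :
    Nonempty (M.Above e (Sum.inr j) (Sum.inr (M.leafOf e j)) ≃ M.Sheet e (Sum.inr j)) := by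
  refine nonempty_equiv_of_forall (D := PUnit) (fun _ => Sum.inl (Sum.inr (Sum.inr j)))
    (fun _ _ _ => rfl) (fun _ => rfl) (fun _ => rfl) ?_
  rintro (((⟨x, _ | _⟩ | p | p) | j' | j') | p | p) h1 h2 <;> simp at h1 h2
  exact ⟨PUnit.unit, by rw [h1]⟩

theorem treeBase_eq_none {t : (M.Node e × Bool) ⊕ M.Leaf e} (h : M.treeBase e t = none) :
    t = Sum.inl (none, false) ∨ ∃ f, t = Sum.inl (some (some f), false) := by
  rcases t with ⟨_ | _ | f, _ | _⟩ | l
  · simp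
  · cases h
  · cases h
  · cases h
  · simp
  · cases h
  · cases h

theorem treeBase_eq_some_none {t : (M.Node e × Bool) ⊕ M.Leaf e}
    (h : M.treeBase e t = some none) :
    t = Sum.inl (none, true) ∨ t = Sum.inl (some none, false) := by
  rcases t with ⟨_ | _ | f, _ | _⟩ | l
  · cases h
  · simp
  · simp
  · cases h
  · cases h
  · cases h
  · cases h

theorem treeBase_eq_some_some {t : (M.Node e × Bool) ⊕ M.Leaf e} {l : M.Leaf e}
    (h : M.treeBase e t = some (some l)) :
    t = Sum.inl (some l, true) ∨ t = Sum.inr l := by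
  rcases t with ⟨_ | _ | f, _ | _⟩ | l
  · cases h
  · cases h
  · cases h
  · cases h
    simp
  · cases h
  · cases h
    simp
  · cases h
    simp

theorem nonempty_above_equiv_sheet (v : M.ModV e) (t : (M.Node e × Bool) ⊕ M.Leaf e)
    (h : M.treeBase e t = M.projV e v) : Nonempty (M.Above e v t ≃ M.Sheet e v) := by
  rcases v with (a | f) | j
  · by_cases ha : a = e
    · subst ha
      rw [projV_self] at h
      rcases treeBase_eq_some_some h with rfl | rfl
      · exact above_self_edge
      · exact above_self_leg
    · rw [projV_element ha] at h
      rcases treeBase_eq_none h with rfl | ⟨f, rfl⟩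
      · exact above_element_pencil ha
      · exact above_element_flat ha f.1 f.2
  · by_cases hf : e ∈ f.1
    · rw [projV_flat_mem hf] at h
      rcases treeBase_eq_some_none h with rfl | rfl
      · exact above_pencil_up f hf
      · exact above_pencil_down f hf
    · rw [projV_flat_not_mem hf] at h
      rcases treeBase_eq_some_some h with rfl | rfl
      · exact above_flat_up f hf
      · exact above_flat_leg f hf
  · rcases treeBase_eq_some_some h with rfl | rfl
    · exact above_new_up j
    · exact above_new_leg j

/-! ### The balanced cover and its fiber over the root -/

theorem surjective_projV : Function.Surjective (M.projV e) := by
  rintro (_ | _ | _ | f)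
  · obtain ⟨a, ha⟩ := M.exists_element_ne e
    exact ⟨_, projV_element ha⟩
  · obtain ⟨f, hf⟩ := M.exists_flat_mem e
    exact ⟨_, projV_flat_mem hf⟩
  · exact ⟨_, projV_self⟩
  · exact ⟨_, projV_flat_not_mem f.2⟩

theorem projV_eq_none_iff (v : M.ModV e) :
    M.projV e v = none ↔ ∃ a, a ≠ e ∧ Sum.inl (Sum.inl a) = v := by
  rcases v with (a | f) | j
  · simp [projV]
  · by_cases hf : e ∈ f.1
    · simp [projV_flat_mem hf]
    · simp [projV_flat_not_mem hf]
  · simp [projV]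

variable (M e) in
/-- The projection from `e`. -/
noncomputable def projection :
    BalancedCover (M.modification e) (M.projectionTree e) (M.Sheet e) where
  onV := M.projV e
  onH := M.projH e
  surjective_onV := surjective_projV
  base_onH := M.base_projH e
  inv_onH := by
    rintro (((⟨x, b⟩ | j) | j | j) | p | p)
    · by_cases h1 : x.1.1 = e
      · exact (congrArg (M.projectionTree e).inv (projH_self b h1)).trans (projH_self (!b) h1).symm
      · by_cases h2 : e ∈ x.1.2.1
        · exact (congrArg (M.projectionTree e).inv (projH_mem b h1 h2)).trans
            (projH_mem (!b) h1 h2).symm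
        · exact (congrArg (M.projectionTree e).inv (projH_not_mem b h2)).trans
            (projH_not_mem (!b) h2).symm
    all_goals rfl
  isLeg_onH := by
    rintro (((⟨x, b⟩ | j) | j | j) | p | p)
    · have hT : ∀ n b', ¬ (M.projectionTree e).IsLeg (Sum.inl (n, b')) := fun n b' h =>
        Bool.not_ne_self b' (congrArg Prod.snd (Sum.inl_injective h))
      refine iff_of_false ?_ fun h => ?_
      · obtain ⟨-, h⟩ | ⟨-, -, h⟩ | ⟨-, _, h⟩ := projH_flag (e := e) x b
        all_goals exact fun h' => hT _ _ ((congrArg (M.projectionTree e).IsLeg h).mp h')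
      · exact Bool.not_ne_self b
          (congrArg Prod.snd (Sum.inl_injective (Sum.inl_injective (Sum.inl_injective h))))
    · refine iff_of_false (fun h => ?_) (fun h => ?_) <;> cases h
    · refine iff_of_false (fun h => ?_) (fun h => ?_) <;> cases h
    all_goals exact iff_of_true rfl rfl
  len_onH := by
    -- All bounded edges on both sides have length one.
    rintro (((h | j) | j | j) | p | p) hh
    · rfl
    · rfl
    · rfl
    · rfl
    · exact (hh rfl).elim
    · exact (hh rfl).elim
  balanced := nonempty_above_equiv_sheet

theorem card_sheet_element {a : E} (ha : a ≠ e) :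
    Nat.card (M.Sheet e (Sum.inl (Sum.inl a))) = 1 := by
  rw [Nat.card_eq_one_iff_unique]
  exact ⟨M.subsingleton_sheet_element e ha, M.nonempty_sheet_element e a⟩

-- Over the root lie exactly the elements other than `e`, each with a single sheet; neither flats
-- nor glued vertices map there.
variable (M e) in
theorem sum_card_sheet_eq_mapDomain [Fintype (M.ModV e)] [∀ v, Fintype (M.Sheet e v)]
    [DecidablePred fun v => M.projV e v = none] :
    ∑ v : M.ModV e with M.projV e v = none,
        Finsupp.single v (Fintype.card (M.Sheet e v) : ℤ) =
      (∑ a : E, Finsupp.single (Sum.inl a : E ⊕ M.Flat) (1 : ℤ) -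
        Finsupp.single (Sum.inl e : E ⊕ M.Flat) 1).mapDomain Sum.inl := by
  classical
  rw [← Finset.add_sum_erase _ _ (Finset.mem_univ e), add_sub_cancel_left,
    Finsupp.mapDomain_finsetSum]
  symm
  refine Finset.sum_bij (fun a _ => (Sum.inl (Sum.inl a) : M.ModV e)) ?_ ?_ ?_ ?_
  · intro a ha
    rw [Finset.mem_filter]
    exact ⟨Finset.mem_univ _, projV_element (Finset.ne_of_mem_erase ha)⟩
  · intro a _ b _ h
    exact Sum.inl_injective (Sum.inl_injective h)
  · intro v hv
    obtain ⟨a, ha, rfl⟩ := (projV_eq_none_iff v).1 (Finset.mem_filter.1 hv).2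
    exact ⟨a, Finset.mem_erase.2 ⟨ha, Finset.mem_univ _⟩, rfl⟩
  · intro a ha
    rw [Finsupp.mapDomain_single, ← Nat.card_eq_fintype_card,
      card_sheet_element (Finset.ne_of_mem_erase ha), Nat.cast_one]

end RankThreeSimpleMatroid

end TropLift

theorem proposition2p3 {E : Type u} [Fintype E] (M : RankThreeSimpleMatroid E) (e : E)
    (k : Type v) [Field k] [IsAlgClosed k] (hk : ringChar k ≠ 2) :
    ∃ (Γ : MetricGraph.{u}) (ι : M.leviGraph.V → Γ.V),
      IsTropicalModification M.leviGraph Γ ι ∧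
      ∃ (X : TotallyDegenerateComplex k Γ)
        (T : MetricGraph.{u}) (Y : TotallyDegenerateComplex k T),
        Y.genus = 0 ∧
        ∃ φ : FiniteHarmonicMorphism X Y, φ.IsTame ∧
          ∃ (w : T.V) (y : OnePoint k),
            X.toGraphDivisor (φ.fiber w y) =
              (M.matroidDivisor - M.elementDivisor e).mapDomain ι := by
  have : ∀ v : (M.modification e).V, Nonempty (M.Sheet e v) := M.nonempty_sheet e
  let i : ∀ v : M.ModV e, Fintype (M.Sheet e v) := fun v => Fintype.ofFinite _
  let _ : ∀ v : (M.modification e).V, Fintype (M.Sheet e v) := i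
  -- The fiber is taken on the curve at the root `none`.
  obtain ⟨X, Y, φ, hφ, y, hy⟩ := (M.projection e).exists_isTame_fiber k hk
    (none : Option (M.Node e))
  refine ⟨_, _, M.isTropicalModification_modification e, X, _, Y, M.firstBetti_projectionTree e,
    φ, hφ, none, y, hy.trans ?_⟩
  exact @RankThreeSimpleMatroid.sum_card_sheet_eq_mapDomain E _ M e (M.modification e).fintypeV i
    (Classical.decPred _)
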